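/- **Definitions (stellar resolution).** Fix a coloured signature: a countably infinite set of variables, countably many function symbols with arities, and a subset of them called colours. A *ray* is $+c(t_1,\dots,t_n)$, $-c(t_1,\dots,t_n)$ ($c$ an $n$-ary colour) or a term; a *star* is a finite non-empty multiset of rays; a *constellation* is a countable family of stars. Two rays are *dual* if they have the same colour and opposite signs and their underlying terms are unifiable after renaming the variables of one of them. A *diagram* over a constellation is a finite connected graph whose vertices are occurrences of stars and whose edges are pairs of dual ray occurrences, each ray occurrence being used by at most one edge; the other ray occurrences are *free*. It is *correct* if it has a free ray and the equations along its edges (with the variables of distinct vertices made disjoint) are simultaneously solvable; its *actualisation* is then the star of its free rays under a most general solution. It is *saturated* if it is maximal for inclusion of diagrams. The *execution* $\mathrm{Ex}(\Sigma)$ is the set of actualisations of correct saturated diagrams over $\Sigma$ (with respect to all colours). **Encoding.** Take a constant $0$, unary symbols $s$ and $c$ for every side colour $c$, and ternary colours $h,v$. A Wang tile $t=(c_w,c_e,c_s,c_n)$ is encoded by the star $$t^\bigstar=[-h(c_w(x),x,y),\,-v(c_s(y),x,y),\,+h(c_e(s(x)),s(x),y),\,+v(c_n(s(y)),x,s(y))].$$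 A tile *pinned* to the cell $(a,b)\in\mathbb N^2$ may be used in this cell only and is encoded by the instance $x:=s^a(0)$, $y:=s^b(0)$ of $t^\bigstar$. A finite family $T$ of tiles, some of which may be pinned, is encoded by the constellation $T^\bigstar$ of the stars of its members. A *placement* of a diagram over $T^\bigstar$ maps its vertices to $\mathbb N^2$ so that pinned tiles are at their cells and every edge joins the east side of a tile to the west side of the tile in the next cell to the east, or the north side of a tile to the south side of the tile in the next cell to the north, the two sides having the same colour. A placed diagram is *flat* if no cell is used twice and any two tiles in adjacent cells are joined along their common side. **Theorem (Turing-completeness).** (I) *Diagrams and tilings.* Let $T$ be a finite family of Wang tiles, some possibly pinned, with countably many side colours. 1. A diagram over $T^\bigstar$ is correct if and only if it has a placement, and any two placements of it differ by a translation. 2. For every tiling of a finite connected region $D\subset\mathbb N^2$ by $T$ (a map $D\to T$ respecting pins, such that adjacent sides have equal colours) there is a correct diagram with a flat placement onto $D$ that carries the given tile in every cell of $D$, and it is unique up to isomorphism. Conversely, every flat placed diagram arises in this way from a tiling of a finite connected region. (II) *Simulation of Turing machines.* Let $M$ be a Turing machine with finitely many states $Q$, finite tape alphabet $\Gamma$ and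 one right-infinite tape (a left move on the leftmost cell leaves the head in place; $M$ halts when no transition is defined). The *content* of tape cell $i$ in a configuration is its symbol together with the state if the head is on it; inputs are written from cell $0$, where the head starts. There are a finite set of side colours, a finite family $T_M$ of unpinned Wang tiles, two maps from $\Gamma\times(Q\sqcup\{\text{none}\})$ to tiles (for input tiles and for last input tiles), and a map $\mathrm{dec}$ from side colours to $\Gamma\times(Q\sqcup\{\text{none}\})$, all depending only on $M$, such that the following holds for every input $w\in\Gamma^*$. Let $\Sigma_{M,w}$ encode $T_M$ together with, for $0\le i\le|w|$, the input tile (for $i=|w|$: the last-input tile) of the initial content of cell $i$, pinned to $(i,0)$. 1. $M$ halts on $w$ if and only if $\mathrm{Ex}(\Sigma_{M,w})\neq\emptyset$. 2. If $M$ halts on $w$ after $n$ steps in the configuration $c$, then for every star $\sigma\in\mathrm{Ex}(\Sigma_{M,w})$ there is an $N$, at least the head position in $c$ and such that the tape of $c$ is blank beyond $N$, for which the rays of $\sigma$ of the form $+v(\dots)$ are all of the form $+v(a(s^{n+2}(0)),s^i(0),s^{n+2}(0))$ with $i\le N$ and $\mathrm{dec}(a)$ the content of cell $i$ in $c$, and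 such a ray occurs for every $i\le N$. 3. If $M$ makes at least $n$ steps on $w$ and $N>|w|+n$, there is a correct diagram over $\Sigma_{M,w}$ with a flat placement onto $\{0,\dots,N\}\times\{0,\dots,n\}$ in which every free ray that is dual to some ray of $\Sigma_{M,w}$ is the northern ray of its tile, and such that $\mathrm{dec}$ of the north colour of the tile at $(i,j)$ is the content of cell $i$ after $j$ steps. 4. Conversely, in every correct diagram over $\Sigma_{M,w}$ in which every free ray that is dual to some ray of $\Sigma_{M,w}$ is the northern ray of its tile, for every placement and every vertex, placed at $(i,j)$ say, $\mathrm{dec}$ of the north colour of its tile is the content of cell $i$ after $j$ steps of $M$ on $w$, or $M$ halts after exactly $j-1$ steps and it is the content of cell $i$ in the final configuration. -/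

import Mathlib

/-! # Stellar resolution -/

namespace Stellar

/-- A coloured signature: countably many function symbols with arities (`lang.Functions n` is the
set of symbols of arity `n`) and a distinguished set of colours among them.
The countably infinite set of variables is `ℕ`. -/
structure ColouredSignature where
  lang : FirstOrder.Language.{0, 0}
  countable_functions : Countable (Σ n, lang.Functions n)
  colours : Set (Σ n, lang.Functions n)

variable {S : ColouredSignature}

/-- First-order terms over the signature. -/
abbrev ColouredSignature.Term (S : ColouredSignature) : Type := S.lang.Term ℕ

/-- `θ` solves the unification problem `P` (a set of equations). -/
def IsSolution (P : Set (S.Term × S.Term)) (θ : ℕ → S.Term) : Prop :=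
  ∀ e ∈ P, e.1.subst θ = e.2.subst θ

/-- `ψ` is a minimal solution of `P`: every other solution factors through it. -/
def IsMinimalSolution (P : Set (S.Term × S.Term)) (ψ : ℕ → S.Term) : Prop :=
  IsSolution P ψ ∧ ∀ θ, IsSolution P θ → ∃ θ₁ : ℕ → S.Term, ∀ x, θ x = (ψ x).subst θ₁

/-- Two terms are matchable if they become unifiable after renaming the variables of one. -/
def Matchable (t u : S.Term) : Prop :=
  ∃ α : ℕ → ℕ, ∃ θ : ℕ → S.Term, IsSolution {(t.relabel α, u)} θ

inductive Polarity
  | pos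
  | neg

/-- Rays: `+c(t₁,…,tₙ)`, `-c(t₁,…,tₙ)` with `c` a colour of arity `n`, or an uncoloured term. -/
inductive Ray (S : ColouredSignature) : Type
  | polarised (p : Polarity) (c : S.colours) (ts : Fin c.1.1 → S.Term) : Ray S
  | neutral (t : S.Term) : Ray S

/-- The underlying term of a ray. -/
def Ray.floor : Ray S → S.Term
  | .polarised _ c ts => FirstOrder.Language.Term.func c.1.2 ts
  | .neutral t => t

/-- Action of a substitution on a ray. -/
def Ray.subst (θ : ℕ → S.Term) : Ray S → Ray S
  | .polarised p c ts => .polarised p c (fun i => (ts i).subst θ)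
  | .neutral t => .neutral (t.subst θ)

/-- A star is a finite non-empty family of rays; the order of the list carries no meaning, its
positions serve as names of the ray occurrences. -/
abbrev Star (S : ColouredSignature) : Type := {l : List (Ray S) // l ≠ []}

/-- A constellation is a countable family of stars. -/
structure Constellation (S : ColouredSignature) where
  index : Type
  countable_index : Countable index
  star : index → Star S

/-- Duality of rays with respect to the set `A` of colours. -/
def Dual (A : Set S.colours) (r s : Ray S) : Prop :=
  ∃ c ∈ A, ∃ ts us : Fin c.1.1 → S.Term,
    ((r = .polarised .pos c ts ∧ s = .polarised .neg c us) ∨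
      (r = .polarised .neg c ts ∧ s = .polarised .pos c us)) ∧
    Matchable r.floor s.floor

/-- An `A`-diagram over the constellation `K`: a finite connected multigraph with a homomorphism
to the unification graph of `K` that is injective on rays.
The vertices are `0, …, size - 1` and the vertex `v` is an occurrence of the star `star v`.
A ray occurrence is a pair of a vertex and a position in its star; the edges are the unordered
pairs of ray occurrences related by `link`. -/
structure Diagram (A : Set S.colours) (K : Constellation S) where
  size : ℕ
  star : Fin size → K.index
  link : Fin size × ℕ → Fin size × ℕ → Prop
  link_symm : ∀ a b, link a b → link b a
  link_dual : ∀ a b, link a b → ∃ r s : Ray S,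
    (K.star (star a.1)).1[a.2]? = some r ∧ (K.star (star b.1)).1[b.2]? = some s ∧ Dual A r s
  link_injective : ∀ a b c, link a b → link a c → b = c
  connected : (SimpleGraph.fromRel fun u v => ∃ i j, link (u, i) (v, j)).Connected

namespace Diagram

variable {A : Set S.colours} {K : Constellation S}

/-- `r` is the ray at the ray occurrence `a`. -/
def HasRay (δ : Diagram A K) (a : Fin δ.size × ℕ) (r : Ray S) : Prop :=
  (K.star (δ.star a.1)).1[a.2]? = some r

/-- The free ray occurrences of a diagram. -/
def free (δ : Diagram A K) : Set (Fin δ.size × ℕ) :=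
  {a | (∃ r, δ.HasRay a r) ∧ ∀ b, ¬ δ.link a b}

/-- The renaming applied to the star at the vertex `v`; distinct vertices get disjoint variables. -/
def rename (v x : ℕ) : S.Term := FirstOrder.Language.Term.var (Nat.pair v x)

/-- The underlying unification problem. -/
def problem (δ : Diagram A K) : Set (S.Term × S.Term) :=
  {e | ∃ a b r s, δ.link a b ∧ δ.HasRay a r ∧ δ.HasRay b s ∧
    e = (r.floor.subst (rename a.1), s.floor.subst (rename b.1))}

def Correct (δ : Diagram A K) : Prop :=
  δ.free.Nonempty ∧ ∃ θ, IsSolution δ.problem θ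

/-- `δ` is isomorphic to a sub-diagram of `η`. -/
def Sub (δ η : Diagram A K) : Prop :=
  ∃ f : Fin δ.size ↪ Fin η.size, (∀ v, η.star (f v) = δ.star v) ∧
    ∀ u i v j, δ.link (u, i) (v, j) → η.link (f u, i) (f v, j)

/-- Maximal diagrams. -/
def Saturated (δ : Diagram A K) : Prop := ∀ η : Diagram A K, δ.Sub η → η.Sub δ

/-- `σ` is the actualisation of `δ` (which is determined up to the names of variables and of ray
occurrences): its ray occurrences are the free ray occurrences of `δ`, to which a minimal solution
of the underlying unification problem is applied. -/
def IsActualisation (δ : Diagram A K) (σ : Star S) : Prop :=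
  ∃ ψ : ℕ → S.Term, IsMinimalSolution δ.problem ψ ∧
    ∃ e : Fin σ.1.length ≃ δ.free, ∀ k r, δ.HasRay (e k).1 r →
      σ.1.get k = (r.subst (rename (e k).1.1)).subst ψ

end Diagram

/-- The execution of `K`: the actualisations of its correct saturated diagrams. -/
def exec (A : Set S.colours) (K : Constellation S) : Set (Star S) :=
  {σ | ∃ δ : Diagram A K, δ.Correct ∧ δ.Saturated ∧ δ.IsActualisation σ}

end Stellar

/-! # Wang tiles and their encoding -/

namespace Wang

open Stellar

structure Tile (C : Type) where
  west : C
  east : C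
  south : C
  north : C

/-- The function symbols of the encoding: `0`, `s`, a unary symbol for every side colour, and the
two ternary symbols for the horizontal and the vertical axis. -/
inductive Fn (C : Type) : ℕ → Type
  | zero : Fn C 0
  | succ : Fn C 1
  | side : C → Fn C 1
  | horizontal : Fn C 3
  | vertical : Fn C 3

theorem countable_fn (C : Type) [Countable C] : Countable (Σ n, Fn C n) := by
  let g : (Fin 4 ⊕ C) → Σ n, Fn C n := fun x => match x with
    | .inl 0 => ⟨0, .zero⟩
    | .inl 1 => ⟨1, .succ⟩
    | .inl 2 => ⟨3, .horizontal⟩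
    | .inl 3 => ⟨3, .vertical⟩
    | .inr c => ⟨1, .side c⟩
  have hg : Function.Surjective g := by
    rintro ⟨n, f⟩
    cases f with
    | zero => exact ⟨.inl 0, rfl⟩
    | succ => exact ⟨.inl 1, rfl⟩
    | side c => exact ⟨.inr c, rfl⟩
    | horizontal => exact ⟨.inl 2, rfl⟩
    | vertical => exact ⟨.inl 3, rfl⟩
  exact hg.countable

/-- The coloured signature of the encoding; its colours are the two axis symbols. -/
def sig (C : Type) [Countable C] : ColouredSignature where
  lang := ⟨Fn C, fun _ => Empty⟩
  countable_functions := countable_fn C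
  colours := {⟨3, Fn.horizontal⟩, ⟨3, Fn.vertical⟩}

section

variable {C : Type} [Countable C]

def hColour : (sig C).colours := ⟨⟨3, Fn.horizontal⟩, Or.inl rfl⟩

def vColour : (sig C).colours := ⟨⟨3, Fn.vertical⟩, Or.inr rfl⟩

def var (n : ℕ) : (sig C).Term := FirstOrder.Language.Term.var n

/-- The term `s(t)`. -/
def succ (t : (sig C).Term) : (sig C).Term :=
  FirstOrder.Language.Term.func (L := (sig C).lang) (Fn.succ : Fn C 1) ![t]

/-- The term `c(t)` for a side colour `c`. -/
def side (c : C) (t : (sig C).Term) : (sig C).Term :=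
  FirstOrder.Language.Term.func (L := (sig C).lang) (Fn.side c : Fn C 1) ![t]

/-- The numeral `sⁿ(0)`. -/
def num : ℕ → (sig C).Term
  | 0 => FirstOrder.Language.Term.func (L := (sig C).lang) (Fn.zero : Fn C 0) ![]
  | n + 1 => succ (num n)

/-- The ray `±h(c(x), x, y)`. -/
def hRay (p : Polarity) (c : C) (x y : (sig C).Term) : Ray (sig C) :=
  .polarised p hColour ![side c x, x, y]

/-- The ray `±v(c(y), x, y)`. -/
def vRay (p : Polarity) (c : C) (x y : (sig C).Term) : Ray (sig C) :=
  .polarised p vColour ![side c y, x, y]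

/-- The star of a tile with coordinates `x`, `y`:
`[-h(c_w(x), x, y), -v(c_s(y), x, y), +h(c_e(s(x)), s(x), y), +v(c_n(s(y)), x, s(y))]`. -/
def tileStar (t : Tile C) (x y : (sig C).Term) : Star (sig C) :=
  ⟨[hRay .neg t.west x y, vRay .neg t.south x y,
    hRay .pos t.east (succ x) y, vRay .pos t.north x (succ y)], by simp⟩

end

/-- Positions of the four rays in the star of a tile. -/
abbrev W : ℕ := 0
abbrev S : ℕ := 1
abbrev E : ℕ := 2
abbrev N : ℕ := 3

/-- A finite family of Wang tiles; some of them may be pinned to a cell of `ℕ²`, in which case they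
may be used in that cell only. -/
structure TileSet (C : Type) where
  index : Type
  finite_index : Finite index
  tile : index → Tile C
  pin : index → Option (ℕ × ℕ)

section

variable {C : Type} [Countable C]

/-- The constellation of a tile set. A tile becomes a star with variable coordinates, a tile pinned
to `(a, b)` becomes the instance of that star at the coordinates `sᵃ(0)`, `sᵇ(0)`. -/
def TileSet.constellation (T : TileSet C) : Constellation (sig C) where
  index := T.index
  countable_index := have := T.finite_index; inferInstance
  star i := match T.pin i with
    | none => tileStar (T.tile i) (var 0) (var 1)
    | some q => tileStar (T.tile i) (num q.1) (num q.2)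

/-- Diagrams of a tile set, with respect to both colours. -/
abbrev TileSet.Diag (T : TileSet C) : Type := Diagram Set.univ T.constellation

end

/-- `τ` tiles the finite region `D`: adjacent sides of tiles in `D` have the same colour, and pinned
tiles are at their place. -/
def IsTiling {C : Type} (T : TileSet C) (D : Finset (ℕ × ℕ)) (τ : ℕ × ℕ → T.index) : Prop :=
  (∀ d ∈ D, ∀ q, T.pin (τ d) = some q → d = q) ∧
  (∀ d ∈ D, d + (1, 0) ∈ D → (T.tile (τ d)).east = (T.tile (τ (d + (1, 0)))).west) ∧
  (∀ d ∈ D, d + (0, 1) ∈ D → (T.tile (τ d)).north = (T.tile (τ (d + (0, 1)))).south)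

/-- A region is connected if it is (non-empty and) connected as a subgraph of the grid `ℕ²`. -/
def ConnectedRegion (D : Finset (ℕ × ℕ)) : Prop :=
  ((SimpleGraph.hasse ℕ □ SimpleGraph.hasse ℕ).induce (D : Set (ℕ × ℕ))).Connected

section

variable {C : Type} [Countable C] {T : TileSet C}

/-- `p` places the vertices of the diagram in `ℕ²`: pinned tiles are at their place, and every edge
joins the east side of a tile to the west side of the tile in the next cell to the east, or the
north side of a tile to the south side of the tile in the next cell to the north, where the two
sides have the same colour. -/
def IsPlacement (δ : T.Diag) (p : Fin δ.size → ℕ × ℕ) : Prop :=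
  (∀ v q, T.pin (δ.star v) = some q → p v = q) ∧
  ∀ u i v j, δ.link (u, i) (v, j) →
    (i = E ∧ j = W ∧ p v = p u + (1, 0) ∧
      (T.tile (δ.star u)).east = (T.tile (δ.star v)).west) ∨
    (i = W ∧ j = E ∧ p u = p v + (1, 0) ∧
      (T.tile (δ.star v)).east = (T.tile (δ.star u)).west) ∨
    (i = N ∧ j = S ∧ p v = p u + (0, 1) ∧
      (T.tile (δ.star u)).north = (T.tile (δ.star v)).south) ∨
    (i = S ∧ j = N ∧ p u = p v + (0, 1) ∧
      (T.tile (δ.star v)).north = (T.tile (δ.star u)).south)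

/-- The placed diagram is flat: no cell is used twice, and tiles in adjacent cells are joined. -/
def IsFlat (δ : T.Diag) (p : Fin δ.size → ℕ × ℕ) : Prop :=
  IsPlacement δ p ∧ Function.Injective p ∧
  (∀ u v, p v = p u + (1, 0) → δ.link (u, E) (v, W)) ∧
  (∀ u v, p v = p u + (0, 1) → δ.link (u, N) (v, S))

/-- Only northern sides can still be connected: every free ray that is dual to some ray of the
constellation is the northern ray of its tile. -/
def OpenToNorthOnly (δ : T.Diag) : Prop :=
  ∀ a ∈ δ.free, ∀ r, δ.HasRay a r →
    (∃ i, ∃ s ∈ (T.constellation.star i).1, Dual Set.univ r s) → a.2 = N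

end

end Wang

/-! # Turing machines with a single right-infinite tape -/

namespace RightTM

inductive Move
  | left
  | right
  | stay

/-- A machine with states `Q` and tape symbols `Γ`; it halts where `trans` is undefined. -/
structure Machine (Q Γ : Type) where
  start : Q
  blank : Γ
  trans : Q → Γ → Option (Q × Γ × Move)

structure Config (Q Γ : Type) where
  state : Q
  head : ℕ
  tape : ℕ → Γ

variable {Q Γ : Type}

/-- New head position; a left move on the leftmost cell leaves the head in place. -/
def Move.apply : Move → ℕ → ℕ
  | .left, i => i - 1
  | .right, i => i + 1
  | .stay, i => i

def Machine.step (M : Machine Q Γ) (c : Config Q Γ) : Option (Config Q Γ) :=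
  (M.trans c.state (c.tape c.head)).map fun x =>
    ⟨x.1, x.2.2.apply c.head, Function.update c.tape c.head x.2.1⟩

/-- The initial configuration on input `w`. -/
def Machine.init (M : Machine Q Γ) (w : List Γ) : Config Q Γ :=
  ⟨M.start, 0, fun i => w.getD i M.blank⟩

/-- The configuration after `n` steps on input `w`, if the machine makes that many steps. -/
def Machine.run (M : Machine Q Γ) (w : List Γ) : ℕ → Option (Config Q Γ)
  | 0 => some (M.init w)
  | n + 1 => (M.run w n).bind M.step

def Machine.Halts (M : Machine Q Γ) (w : List Γ) : Prop :=
  ∃ n c, M.run w n = some c ∧ M.step c = none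

open Classical in
/-- The content of a cell: its symbol, and the state if the head is on the cell. -/
noncomputable def Config.cell (c : Config Q Γ) (i : ℕ) : Γ × Option Q :=
  (c.tape i, if c.head = i then some c.state else none)

/-- The program tiles together with the tiles of the input `w`, which are pinned to the cells
`(0, 0), …, (|w|, 0)` of the bottom row. An input tile depends only on the content of its cell in
the initial configuration and on whether it is the last one. -/
noncomputable def Machine.tileSet (M : Machine Q Γ) {C : Type} {k : ℕ}
    (program : Fin k → Wang.Tile C) (input lastInput : Γ × Option Q → Wang.Tile C)
    (w : List Γ) : Wang.TileSet C where
  index := Fin k ⊕ Fin (w.length + 1)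
  finite_index := inferInstance
  tile := Sum.elim program fun i =>
    if (i : ℕ) = w.length then lastInput ((M.init w).cell i) else input ((M.init w).cell i)
  pin := Sum.elim (fun _ => none) fun i => some ((i : ℕ), 0)

end RightTM

/-! Tilings. The equation of an east-west edge, h(c(s(x)), s(x), y) = h(c'(x'), x', y'), says
exactly that c = c', x' = s(x) and y' = y; north-south edges are analogous. A solution therefore
gives every vertex a pair of coordinate terms that gain one `s` along each edge. Counting the
leading successors turns it into a placement, and the numerals of a placement solve the equations
(`correct_iff`). In a flat diagram the links are exactly the touching sides, so it carries the same
information as a tiling.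

Saturation. A diagram is saturated iff it is closed: no free ray is dual to a ray of the
constellation (`Saturated.closed`, `Closed.saturated`). Guard tiles turn this into an obligation.
Every colour except those reserved for borders fits some guard, so an unpinned tile cannot leave
such a side open. A guard in turn asks for tiles with the same guard colour without end, to the west
or to the east, so guards occur in no finite diagram without open western and eastern sides
(`not_westGuard`, `not_eastGuard`).

Simulation. The north sides of row j show the configuration after j steps. A cell tile holds the
contents of its cell and of both neighbours; the colour between two tiles of a row names the
contents on either side of it, so the tiles of a row agree on them, and the northern content follows
by the local rule of the machine (`next_eq_cell`). A bit shared by the whole row tells whether the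
machine halts, and the tile under the head vouches for it. In a halting row the north sides get
`result` colours, which fit no south side. In any other row they fit a guard, so a closed diagram
must continue upwards. A finite closed diagram hence exists exactly for halting runs. It contains a
pinned tile, so all its coordinates are ground, and its top row puts the final configuration into
the actualisation (`shows`, `exec_spec`). -/

namespace Stellar.Diagram

variable {S : ColouredSignature} {A : Set S.colours} {K : Constellation S}

/-- Connectedness as an induction principle: what spreads along links from one vertex reaches all of
them. -/
theorem link_induction (δ : Diagram A K) {P : Fin δ.size → Prop}
    (h : ∀ u i v j, δ.link (u, i) (v, j) → P u → P v) {u : Fin δ.size} (hu : P u)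
    (v : Fin δ.size) : P v := by
  obtain ⟨q⟩ := δ.connected.preconnected u v
  induction q with
  | nil => exact hu
  | cons hadj _ ih =>
    apply ih
    rw [SimpleGraph.fromRel_adj] at hadj
    rcases hadj.2 with ⟨i, j, hl⟩ | ⟨i, j, hl⟩
    · exact h _ _ _ _ hl hu
    · exact h _ _ _ _ (δ.link_symm _ _ hl) hu

theorem nonempty_vertices (δ : Diagram A K) : Nonempty (Fin δ.size) := δ.connected.nonempty

end Stellar.Diagram

namespace Wang

open Stellar

/-! ### Terms of the encoding: substitution, injectivity, counting successors -/

section Terms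

variable {C : Type} [Countable C]

@[simp] theorem subst_var (θ : ℕ → (sig C).Term) (n : ℕ) :
    FirstOrder.Language.Term.subst (var n) θ = θ n := rfl

@[simp] theorem subst_succ (θ : ℕ → (sig C).Term) (t : (sig C).Term) :
    (succ t).subst θ = succ (t.subst θ) := by
  simp only [succ, FirstOrder.Language.Term.subst]
  congr 1
  funext i
  fin_cases i; rfl

@[simp] theorem subst_side (θ : ℕ → (sig C).Term) (c : C) (t : (sig C).Term) :
    (side c t).subst θ = side c (t.subst θ) := by
  simp only [side, FirstOrder.Language.Term.subst]
  congr 1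
  funext i
  fin_cases i; rfl

@[simp] theorem subst_num (θ : ℕ → (sig C).Term) (n : ℕ) :
    (num n : (sig C).Term).subst θ = num n := by
  induction n with
  | zero =>
    simp only [num, FirstOrder.Language.Term.subst]
    congr 1
    funext i
    exact i.elim0
  | succ n ih => simp [num, ih]

@[simp] theorem relabel_var (α : ℕ → ℕ) (n : ℕ) :
    FirstOrder.Language.Term.relabel α (var n : (sig C).Term) = var (α n) := rfl

@[simp] theorem relabel_succ (α : ℕ → ℕ) (t : (sig C).Term) :
    (succ t).relabel α = succ (t.relabel α) := by
  simp only [succ, FirstOrder.Language.Term.relabel]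
  congr 1
  funext i
  fin_cases i; rfl

@[simp] theorem relabel_side (α : ℕ → ℕ) (c : C) (t : (sig C).Term) :
    (side c t).relabel α = side c (t.relabel α) := by
  simp only [side, FirstOrder.Language.Term.relabel]
  congr 1
  funext i
  fin_cases i; rfl

@[simp] theorem relabel_num (α : ℕ → ℕ) (n : ℕ) :
    (num n : (sig C).Term).relabel α = num n := by
  induction n with
  | zero =>
    simp only [num, FirstOrder.Language.Term.relabel]
    congr 1
    funext i
    exact i.elim0
  | succ n ih => simp [num, ih]

@[simp] theorem succ_inj {t u : (sig C).Term} : succ t = succ u ↔ t = u := by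
  constructor
  · intro h
    unfold succ at h
    injection h with _ _ h
    exact congrFun h 0
  · rintro rfl; rfl

@[simp] theorem side_inj {c d : C} {t u : (sig C).Term} :
    side c t = side d u ↔ c = d ∧ t = u := by
  constructor
  · intro h
    unfold side at h
    injection h with _ h' h
    have h' : (Fn.side c : Fn C 1) = Fn.side d := h'
    injection h' with h'
    exact ⟨h', congrFun h 0⟩
  · rintro ⟨rfl, rfl⟩; rfl

/-- The terms `f(t, u, v)` for a ternary symbol `f`. -/
def ternary (f : Fn C 3) (t u v : (sig C).Term) : (sig C).Term :=
  FirstOrder.Language.Term.func (L := (sig C).lang) f ![t, u, v]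

@[simp] theorem subst_ternary (θ : ℕ → (sig C).Term) (f : Fn C 3) (t u v : (sig C).Term) :
    (ternary f t u v).subst θ = ternary f (t.subst θ) (u.subst θ) (v.subst θ) := by
  simp only [ternary, FirstOrder.Language.Term.subst]
  congr 1
  funext i
  fin_cases i <;> rfl

@[simp] theorem relabel_ternary (α : ℕ → ℕ) (f : Fn C 3) (t u v : (sig C).Term) :
    (ternary f t u v).relabel α = ternary f (t.relabel α) (u.relabel α) (v.relabel α) := by
  simp only [ternary, FirstOrder.Language.Term.relabel]
  congr 1
  funext i
  fin_cases i <;> rfl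

@[simp] theorem ternary_inj {f g : Fn C 3} {t u v t' u' v' : (sig C).Term} :
    ternary f t u v = ternary g t' u' v' ↔ f = g ∧ t = t' ∧ u = u' ∧ v = v' := by
  constructor
  · intro h
    unfold ternary at h
    injection h with _ hf h
    exact ⟨hf, congrFun h 0, congrFun h 1, congrFun h 2⟩
  · rintro ⟨rfl, rfl, rfl, rfl⟩; rfl

@[simp] theorem floor_hRay (p : Polarity) (c : C) (x y : (sig C).Term) :
    (hRay p c x y).floor = ternary .horizontal (side c x) x y := rfl

@[simp] theorem floor_vRay (p : Polarity) (c : C) (x y : (sig C).Term) :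
    (vRay p c x y).floor = ternary .vertical (side c y) x y := rfl

theorem subst_hRay (θ : ℕ → (sig C).Term) (p : Polarity) (c : C) (x y : (sig C).Term) :
    (hRay p c x y).subst θ = hRay p c (x.subst θ) (y.subst θ) := by
  simp only [hRay, Ray.subst]
  congr 1
  funext i
  fin_cases i
  · exact subst_side θ c x
  · rfl
  · rfl

theorem subst_vRay (θ : ℕ → (sig C).Term) (p : Polarity) (c : C) (x y : (sig C).Term) :
    (vRay p c x y).subst θ = vRay p c (x.subst θ) (y.subst θ) := by
  simp only [vRay, Ray.subst]
  congr 1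
  funext i
  fin_cases i
  · exact subst_side θ c y
  · rfl
  · rfl

/-- Whether a function symbol is the successor. -/
def Fn.isSucc : {n : ℕ} → Fn C n → Bool
  | _, .succ => true
  | _, _ => false

/-- The number of successor symbols at the head of a term. -/
def height : (sig C).Term → ℕ
  | .var _ => 0
  | .func (l := l) f ts => if Fn.isSucc (C := C) (n := l) f then (∑ i : Fin l, height (ts i)) + 1 else 0

@[simp] theorem height_succ (t : (sig C).Term) : height (succ t) = height t + 1 := by
  show (if Fn.isSucc (Fn.succ : Fn C 1) then (∑ i : Fin 1, height ((![t] : Fin 1 → _) i)) + 1 else 0) = _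
  simp [Fn.isSucc]

@[simp] theorem height_num (n : ℕ) : height (num n : (sig C).Term) = n := by
  induction n with
  | zero => rfl
  | succ n ih => simp [num, ih]

end Terms

/-! ### Duality of rays and fitting sides -/

section Rays

variable {C : Type} [Countable C]

theorem hColour_ne_vColour : (hColour : (sig C).colours) ≠ vColour := by
  intro h
  have h := congrArg Subtype.val h
  simp only [hColour, vColour] at h
  injection h with _ h
  cases (show (Fn.horizontal : Fn C 3) = Fn.vertical from h)

/-- The sides `i` of `t` and `j` of `u` face each other and have the same colour. -/
def Fits (t u : Tile C) (i j : ℕ) : Prop :=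
  (i = E ∧ j = W ∧ t.east = u.west) ∨ (i = W ∧ j = E ∧ u.east = t.west) ∨
    (i = N ∧ j = S ∧ t.north = u.south) ∨ (i = S ∧ j = N ∧ u.north = t.south)

/-- The side `i` of the cell `d` is the side `j` of the cell `d'`. -/
def Touch (d d' : ℕ × ℕ) (i j : ℕ) : Prop :=
  (i = E ∧ j = W ∧ d' = d + (1, 0)) ∨ (i = W ∧ j = E ∧ d = d' + (1, 0)) ∨
    (i = N ∧ j = S ∧ d' = d + (0, 1)) ∨ (i = S ∧ j = N ∧ d = d' + (0, 1))

theorem Touch.symm {d d' : ℕ × ℕ} {i j : ℕ} (h : Touch d d' i j) : Touch d' d j i := by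
  unfold Touch at *; tauto

/-- A side fixes the direction of the neighbour; hence the links of a tiling use each ray occurrence
at most once. -/
theorem Touch.unique {d d' d'' : ℕ × ℕ} {i j k : ℕ} (h : Touch d d' i j) (h' : Touch d d'' i k) :
    d' = d'' ∧ j = k := by
  simp only [Touch, E, W, N, S, Prod.ext_iff, Prod.fst_add, Prod.snd_add] at *
  omega

/-- The ray of a tile on its side `i`. -/
def sideRay (t : Tile C) (x y : (sig C).Term) (i : ℕ) : Option (Ray (sig C)) :=
  (tileStar t x y).1[i]?

@[simp] theorem sideRay_W (t : Tile C) (x y : (sig C).Term) :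
    sideRay t x y W = some (hRay .neg t.west x y) := rfl
@[simp] theorem sideRay_S (t : Tile C) (x y : (sig C).Term) :
    sideRay t x y S = some (vRay .neg t.south x y) := rfl
@[simp] theorem sideRay_E (t : Tile C) (x y : (sig C).Term) :
    sideRay t x y E = some (hRay .pos t.east (succ x) y) := rfl
@[simp] theorem sideRay_N (t : Tile C) (x y : (sig C).Term) :
    sideRay t x y N = some (vRay .pos t.north x (succ y)) := rfl

theorem sideRay_eq_some {t : Tile C} {x y : (sig C).Term} {i : ℕ} {r : Ray (sig C)}
    (h : sideRay t x y i = some r) :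
    (i = W ∧ r = hRay .neg t.west x y) ∨ (i = S ∧ r = vRay .neg t.south x y) ∨
      (i = E ∧ r = hRay .pos t.east (succ x) y) ∨ (i = N ∧ r = vRay .pos t.north x (succ y)) := by
  match i, h with
  | 0, h => exact .inl ⟨rfl, (Option.some.inj h).symm⟩
  | 1, h => exact .inr (.inl ⟨rfl, (Option.some.inj h).symm⟩)
  | 2, h => exact .inr (.inr (.inl ⟨rfl, (Option.some.inj h).symm⟩))
  | 3, h => exact .inr (.inr (.inr ⟨rfl, (Option.some.inj h).symm⟩))
  | n + 4, h => simp [sideRay, tileStar] at h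

theorem matchable_hRay {p p' : Polarity} {c c' : C} {x y x' y' : (sig C).Term}
    (h : Matchable (hRay p c x y).floor (hRay p' c' x' y').floor) : c = c' := by
  obtain ⟨α, θ, h⟩ := h
  have := h _ rfl
  simp at this
  exact this.1.1

theorem matchable_vRay {p p' : Polarity} {c c' : C} {x y x' y' : (sig C).Term}
    (h : Matchable (vRay p c x y).floor (vRay p' c' x' y').floor) : c = c' := by
  obtain ⟨α, θ, h⟩ := h
  have := h _ rfl
  simp at this
  exact this.1.1

/-- Dual rays have the same colour and opposite polarities. -/
theorem Dual.colour {p p' : Polarity} {c c' : (sig C).colours} {ts : Fin c.1.1 → (sig C).Term}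
    {us : Fin c'.1.1 → (sig C).Term} (h : Dual Set.univ (.polarised p c ts) (.polarised p' c' us)) :
    c = c' ∧ p ≠ p' := by
  obtain ⟨d, _, ts', us', h | h, _⟩ := h
  all_goals
    obtain ⟨h1, h2⟩ := h
    injection h1 with h1 h1'
    injection h2 with h2 h2'
    subst h1' h2' h1 h2
    exact ⟨rfl, by simp⟩

theorem Dual.matchable {r s : Ray (sig C)} {A : Set (sig C).colours} (h : Dual A r s) :
    Matchable r.floor s.floor := by
  obtain ⟨d, _, ts', us', _, h⟩ := h
  exact h

/-- Axis symbol and polarity leave only the pairs east-west and north-south; the side colour is the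
head symbol of the first argument and survives every substitution. -/
theorem Dual.fits {t u : Tile C} {x y x' y' : (sig C).Term} {i j : ℕ} {r s : Ray (sig C)}
    (hr : sideRay t x y i = some r) (hs : sideRay u x' y' j = some s)
    (h : Dual Set.univ r s) : Fits t u i j := by
  have hm := Dual.matchable h
  rcases sideRay_eq_some hr with ⟨rfl, rfl⟩ | ⟨rfl, rfl⟩ | ⟨rfl, rfl⟩ | ⟨rfl, rfl⟩ <;>
  rcases sideRay_eq_some hs with ⟨rfl, rfl⟩ | ⟨rfl, rfl⟩ | ⟨rfl, rfl⟩ | ⟨rfl, rfl⟩ <;>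
  first
  | exact absurd rfl (Dual.colour h).2
  | exact absurd (Dual.colour h).1 hColour_ne_vColour
  | exact absurd (Dual.colour h).1 hColour_ne_vColour.symm
  | (have := matchable_hRay hm; simp [Fits, E, W, N, S, this])
  | (have := matchable_vRay hm; simp [Fits, E, W, N, S, this])

end Rays

/-! ### Solutions of the equations and placements -/

section Coordinates

variable {C : Type} [Countable C]

/-- The coordinates of a tile as it occurs in the constellation. -/
def TileSet.coords (T : TileSet C) (i : T.index) : (sig C).Term × (sig C).Term :=
  match T.pin i with
  | none => (var 0, var 1)
  | some q => (num q.1, num q.2)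

variable {T : TileSet C}

theorem constellation_star (i : T.index) :
    T.constellation.star i = tileStar (T.tile i) (T.coords i).1 (T.coords i).2 := by
  rcases h : T.pin i with _ | q <;> simp only [TileSet.constellation, TileSet.coords, h]

theorem star_getElem (i : T.index) (k : ℕ) : (T.constellation.star i).1[k]? =
    sideRay (T.tile i) (T.coords i).1 (T.coords i).2 k := by
  rw [constellation_star]; rfl

theorem hasRay_iff {δ : T.Diag} {a : Fin δ.size × ℕ} {r : Ray (sig C)} :
    δ.HasRay a r ↔ sideRay (T.tile (δ.star a.1)) (T.coords (δ.star a.1)).1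
      (T.coords (δ.star a.1)).2 a.2 = some r :=
  ⟨fun h => (star_getElem _ _).symm.trans h, fun h => (star_getElem _ _).trans h⟩

/-- Shifting by two separates the variables of the first tile from `0` and `1`, so both tiles can be
moved to their cells independently, even if `i = j`. -/
theorem coords_unifier (i j : T.index) (d d' : ℕ × ℕ) (hi : ∀ q, T.pin i = some q → d = q)
    (hj : ∀ q, T.pin j = some q → d' = q) : ∃ θ : ℕ → (sig C).Term,
    ((T.coords i).1.relabel (· + 2)).subst θ = num d.1 ∧
    ((T.coords i).2.relabel (· + 2)).subst θ = num d.2 ∧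
    (T.coords j).1.subst θ = num d'.1 ∧ (T.coords j).2.subst θ = num d'.2 := by
  refine ⟨fun n => match n with
    | 0 => num d'.1 | 1 => num d'.2 | 2 => num d.1 | _ => num d.2, ?_⟩
  simp only [TileSet.coords]
  rcases hpi : T.pin i with _ | q <;> rcases hpj : T.pin j with _ | q' <;> simp
  · rw [hj _ hpj]; simp
  · rw [hi _ hpi]; simp
  · rw [hj _ hpj, hi _ hpi]; simp

theorem dual_h {p p' : Polarity} (hp : p = .pos ∧ p' = .neg ∨ p = .neg ∧ p' = .pos)
    {c c' : C} {x y x' y' : (sig C).Term}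
    (hm : Matchable (hRay p c x y).floor (hRay p' c' x' y').floor) :
    Dual Set.univ (hRay p c x y) (hRay p' c' x' y') := by
  refine ⟨hColour, trivial, ![side c x, x, y], ![side c' x', x', y'], ?_, hm⟩
  rcases hp with ⟨rfl, rfl⟩ | ⟨rfl, rfl⟩
  · exact .inl ⟨rfl, rfl⟩
  · exact .inr ⟨rfl, rfl⟩

theorem dual_v {p p' : Polarity} (hp : p = .pos ∧ p' = .neg ∨ p = .neg ∧ p' = .pos)
    {c c' : C} {x y x' y' : (sig C).Term}
    (hm : Matchable (vRay p c x y).floor (vRay p' c' x' y').floor) :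
    Dual Set.univ (vRay p c x y) (vRay p' c' x' y') := by
  refine ⟨vColour, trivial, ![side c y, x, y], ![side c' y', x', y'], ?_, hm⟩
  rcases hp with ⟨rfl, rfl⟩ | ⟨rfl, rfl⟩
  · exact .inl ⟨rfl, rfl⟩
  · exact .inr ⟨rfl, rfl⟩

/-- Fitting sides of tiles that may be used in neighbouring cells carry dual rays. -/
theorem dual_of_touch (i j : T.index) {k l : ℕ} (d d' : ℕ × ℕ)
    (hi : ∀ q, T.pin i = some q → d = q) (hj : ∀ q, T.pin j = some q → d' = q)
    (ht : Touch d d' k l) (hf : Fits (T.tile i) (T.tile j) k l) :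
    ∃ r s, (T.constellation.star i).1[k]? = some r ∧ (T.constellation.star j).1[l]? = some s ∧
      Dual Set.univ r s := by
  obtain ⟨θ, h1, h2, h3, h4⟩ := coords_unifier i j d d' hi hj
  simp only [star_getElem]
  rcases ht with ⟨rfl, rfl, hd⟩ | ⟨rfl, rfl, hd⟩ | ⟨rfl, rfl, hd⟩ | ⟨rfl, rfl, hd⟩ <;>
  simp [Fits, E, W, N, S] at hf <;>
  refine ⟨_, _, by first | exact sideRay_W .. | exact sideRay_E .. | exact sideRay_N .. | exact sideRay_S ..,
    by first | exact sideRay_W .. | exact sideRay_E .. | exact sideRay_N .. | exact sideRay_S .., ?_⟩ <;>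
  first
  | refine dual_h (by simp) ⟨(· + 2), θ, ?_⟩
  | refine dual_v (by simp) ⟨(· + 2), θ, ?_⟩
  all_goals
    rintro e rfl
    simp [h1, h2, h3, h4, hd, hf, num]

/-- The coordinates of the vertex `v` under the substitution `θ`. -/
def coordAt (δ : T.Diag) (θ : ℕ → (sig C).Term) (v : Fin δ.size) : (sig C).Term × (sig C).Term :=
  (((T.coords (δ.star v)).1.subst (Diagram.rename v)).subst θ,
    ((T.coords (δ.star v)).2.subst (Diagram.rename v)).subst θ)

theorem link_fits {δ : T.Diag} {u v : Fin δ.size} {i j : ℕ} (h : δ.link (u, i) (v, j)) :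
    Fits (T.tile (δ.star u)) (T.tile (δ.star v)) i j := by
  obtain ⟨r, s, hr, hs, hd⟩ := δ.link_dual _ _ h
  exact Dual.fits ((star_getElem _ _).symm.trans hr) ((star_getElem _ _).symm.trans hs) hd

theorem coordAt_east {δ : T.Diag} {θ : ℕ → (sig C).Term} (hθ : IsSolution δ.problem θ)
    {u v : Fin δ.size} (h : δ.link (u, E) (v, W)) :
    (coordAt δ θ v).1 = succ (coordAt δ θ u).1 ∧ (coordAt δ θ v).2 = (coordAt δ θ u).2 := by
  have := hθ _ ⟨_, _, _, _, h, hasRay_iff.2 (sideRay_E ..), hasRay_iff.2 (sideRay_W ..), rfl⟩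
  simp at this
  exact ⟨this.2.1.symm, this.2.2.symm⟩

theorem coordAt_north {δ : T.Diag} {θ : ℕ → (sig C).Term} (hθ : IsSolution δ.problem θ)
    {u v : Fin δ.size} (h : δ.link (u, N) (v, S)) :
    (coordAt δ θ v).1 = (coordAt δ θ u).1 ∧ (coordAt δ θ v).2 = succ (coordAt δ θ u).2 := by
  have := hθ _ ⟨_, _, _, _, h, hasRay_iff.2 (sideRay_N ..), hasRay_iff.2 (sideRay_S ..), rfl⟩
  simp at this
  exact ⟨this.2.1.symm, this.2.2.symm⟩

theorem coordAt_of_pin {δ : T.Diag} {θ : ℕ → (sig C).Term} {v : Fin δ.size} {q : ℕ × ℕ}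
    (h : T.pin (δ.star v) = some q) : coordAt δ θ v = (num q.1, num q.2) := by
  simp [coordAt, TileSet.coords, h]

/-- Linked rays are dual and so have equal side colours; only the geometric half of a placement is a
real condition. -/
theorem isPlacement_iff {δ : T.Diag} {p : Fin δ.size → ℕ × ℕ} : IsPlacement δ p ↔
    (∀ v q, T.pin (δ.star v) = some q → p v = q) ∧
      ∀ u i v j, δ.link (u, i) (v, j) → Touch (p u) (p v) i j := by
  unfold IsPlacement
  refine and_congr_right fun _ => forall_congr' fun u => forall_congr' fun i =>
    forall_congr' fun v => forall_congr' fun j => forall_congr' fun hl => ?_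
  have hf := link_fits hl
  constructor
  · rintro (h | h | h | h)
    · exact .inl ⟨h.1, h.2.1, h.2.2.1⟩
    · exact .inr (.inl ⟨h.1, h.2.1, h.2.2.1⟩)
    · exact .inr (.inr (.inl ⟨h.1, h.2.1, h.2.2.1⟩))
    · exact .inr (.inr (.inr ⟨h.1, h.2.1, h.2.2.1⟩))
  · rintro (⟨rfl, rfl, h⟩ | ⟨rfl, rfl, h⟩ | ⟨rfl, rfl, h⟩ | ⟨rfl, rfl, h⟩) <;>
    simp [Fits, E, W, N, S] at hf <;> simp [E, W, N, S, h, hf]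

/-- The coordinates of a solution need not be numerals, since variables or other terms may remain
below the successors. `height` ignores what is below, adds one for each `succ`, and is exact on the
numerals of pinned tiles. -/
theorem exists_placement_of_solution {δ : T.Diag} {θ : ℕ → (sig C).Term}
    (hθ : IsSolution δ.problem θ) : ∃ p, IsPlacement δ p := by
  refine ⟨fun v => (height (coordAt δ θ v).1, height (coordAt δ θ v).2),
    isPlacement_iff.2 ⟨fun v q hq => by simp [coordAt_of_pin hq], fun u i v j hl => ?_⟩⟩
  have hl' := δ.link_symm _ _ hl
  rcases link_fits hl with ⟨rfl, rfl, -⟩ | ⟨rfl, rfl, -⟩ | ⟨rfl, rfl, -⟩ | ⟨rfl, rfl, -⟩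
  · exact .inl ⟨rfl, rfl, by simp [coordAt_east hθ hl]⟩
  · exact .inr (.inl ⟨rfl, rfl, by simp [coordAt_east hθ hl']⟩)
  · exact .inr (.inr (.inl ⟨rfl, rfl, by simp [coordAt_north hθ hl]⟩))
  · exact .inr (.inr (.inr ⟨rfl, rfl, by simp [coordAt_north hθ hl']⟩))

/-- The substitution that moves every unpinned vertex to its place. -/
def placeSubst {n : ℕ} (p : Fin n → ℕ × ℕ) (x : ℕ) : (sig C).Term :=
  if h : (Nat.unpair x).1 < n then
    if (Nat.unpair x).2 = 0 then num (p ⟨_, h⟩).1 else num (p ⟨_, h⟩).2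
  else var x

theorem coordAt_placeSubst {δ : T.Diag} {p : Fin δ.size → ℕ × ℕ} (hp : IsPlacement δ p)
    (v : Fin δ.size) : coordAt δ (placeSubst p) v = (num (p v).1, num (p v).2) := by
  rcases hq : T.pin (δ.star v) with _ | q
  · simp only [coordAt, TileSet.coords, hq]
    simp [Diagram.rename, placeSubst]
  · rw [coordAt_of_pin hq, hp.1 v q hq]

theorem problem_solution {δ : T.Diag} {θ : ℕ → (sig C).Term} {p : Fin δ.size → ℕ × ℕ}
    (hp : IsPlacement δ p) (hθ : ∀ v, coordAt δ θ v = (num (p v).1, num (p v).2)) :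
    IsSolution δ.problem θ := by
  simp only [coordAt, Prod.mk.injEq] at hθ
  rintro e ⟨⟨u, i⟩, ⟨v, j⟩, r, s, hl, hr, hs, rfl⟩
  rw [hasRay_iff] at hr hs
  have ht := (isPlacement_iff.1 hp).2 _ _ _ _ hl
  have hf := link_fits hl
  rcases ht with ⟨rfl, rfl, h⟩ | ⟨rfl, rfl, h⟩ | ⟨rfl, rfl, h⟩ | ⟨rfl, rfl, h⟩ <;>
  simp [Fits, E, W, N, S] at hf <;> simp at hr hs <;> subst hr hs <;>
  simp [hf, hθ, h, num]

/-- An easternmost tile has nothing to the east of it, so a free ray comes for free with a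
placement. -/
theorem IsPlacement.free_east {δ : T.Diag} {p : Fin δ.size → ℕ × ℕ} (hp : IsPlacement δ p) :
    δ.free.Nonempty := by
  have := δ.nonempty_vertices
  obtain ⟨v, hv⟩ := Finite.exists_max fun v => (p v).1
  refine ⟨(v, E), ⟨_, hasRay_iff.2 (sideRay_E ..)⟩, fun ⟨u, j⟩ hl => ?_⟩
  have := (isPlacement_iff.1 hp).2 _ _ _ _ hl
  have := hv u
  simp only [Touch, E, W, N, S, Prod.ext_iff, Prod.fst_add, Prod.snd_add] at *
  omega

theorem correct_iff {δ : T.Diag} : δ.Correct ↔ ∃ p, IsPlacement δ p :=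
  ⟨fun ⟨_, _, h⟩ => exists_placement_of_solution h, fun ⟨_, hp⟩ =>
    ⟨hp.free_east, _, problem_solution hp (coordAt_placeSubst hp)⟩⟩

/-- Both placements change by the same unit vector along a link. The identity avoids subtraction
because the translation may have negative entries. -/
theorem placement_unique {δ : T.Diag} {p q : Fin δ.size → ℕ × ℕ} (hp : IsPlacement δ p)
    (hq : IsPlacement δ q) (u v : Fin δ.size) : p u + q v = q u + p v := by
  refine δ.link_induction (P := fun v => p u + q v = q u + p v) (fun a i b j hl h => ?_)
    (add_comm _ _) v
  have h1 := (isPlacement_iff.1 hp).2 _ _ _ _ hl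
  have h2 := (isPlacement_iff.1 hq).2 _ _ _ _ hl
  simp only [Touch, E, W, N, S, Prod.ext_iff, Prod.fst_add, Prod.snd_add] at *
  omega

/-- A solution is determined by a placement as soon as one tile is pinned. -/
theorem coordAt_of_solution {δ : T.Diag} {θ : ℕ → (sig C).Term} (hθ : IsSolution δ.problem θ)
    {p : Fin δ.size → ℕ × ℕ} (hp : IsPlacement δ p) {u : Fin δ.size} {q : ℕ × ℕ}
    (hu : T.pin (δ.star u) = some q) (v : Fin δ.size) :
    coordAt δ θ v = (num (p v).1, num (p v).2) := by
  refine δ.link_induction (P := fun v => coordAt δ θ v = (num (p v).1, num (p v).2))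
    (fun a i b j hl h => ?_) (by rw [coordAt_of_pin hu, hp.1 u q hu]) v
  have hl' := δ.link_symm _ _ hl
  rw [Prod.ext_iff] at h ⊢
  rcases (isPlacement_iff.1 hp).2 _ _ _ _ hl with
    ⟨rfl, rfl, e⟩ | ⟨rfl, rfl, e⟩ | ⟨rfl, rfl, e⟩ | ⟨rfl, rfl, e⟩
  · simpa [e, coordAt_east hθ hl, num] using h
  · simpa [e, coordAt_east hθ hl', num] using h
  · simpa [e, coordAt_north hθ hl, num] using h
  · simpa [e, coordAt_north hθ hl', num] using h

end Coordinates

end Wang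

/-! ### Flat diagrams and tilings of finite regions -/

namespace Wang

open Stellar

variable {C : Type} [Countable C] {T : TileSet C}

theorem Touch.grid_adj {d d' : ℕ × ℕ} {i j : ℕ} (h : Touch d d' i j) :
    (SimpleGraph.hasse ℕ □ SimpleGraph.hasse ℕ).Adj d d' := by
  simp only [SimpleGraph.boxProd_adj, SimpleGraph.hasse_adj, Nat.covBy_iff_add_one_eq]
  simp only [Touch, Prod.ext_iff, Prod.fst_add, Prod.snd_add] at h
  omega

theorem exists_touch_of_grid_adj {d d' : ℕ × ℕ}
    (h : (SimpleGraph.hasse ℕ □ SimpleGraph.hasse ℕ).Adj d d') : ∃ i j, Touch d d' i j := by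
  simp only [SimpleGraph.boxProd_adj, SimpleGraph.hasse_adj, Nat.covBy_iff_add_one_eq] at h
  simp only [Touch, Prod.ext_iff, Prod.fst_add, Prod.snd_add]
  rcases h with ⟨h | h, h'⟩ | ⟨h | h, h'⟩
  · exact ⟨E, W, by omega⟩
  · exact ⟨W, E, by omega⟩
  · exact ⟨N, S, by omega⟩
  · exact ⟨S, N, by omega⟩

theorem IsFlat.link_of_touch {δ : T.Diag} {p : Fin δ.size → ℕ × ℕ} (h : IsFlat δ p)
    {u v : Fin δ.size} {i j : ℕ} (ht : Touch (p u) (p v) i j) : δ.link (u, i) (v, j) := by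
  rcases ht with ⟨rfl, rfl, e⟩ | ⟨rfl, rfl, e⟩ | ⟨rfl, rfl, e⟩ | ⟨rfl, rfl, e⟩
  · exact h.2.2.1 _ _ e
  · exact δ.link_symm _ _ (h.2.2.1 _ _ e)
  · exact h.2.2.2 _ _ e
  · exact δ.link_symm _ _ (h.2.2.2 _ _ e)

theorem IsTiling.fits {C : Type} {T : TileSet C} {D : Finset (ℕ × ℕ)} {τ : ℕ × ℕ → T.index} (h : IsTiling T D τ)
    {d d' : ℕ × ℕ} (hd : d ∈ D) (hd' : d' ∈ D) {i j : ℕ} (ht : Touch d d' i j) :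
    Fits (T.tile (τ d)) (T.tile (τ d')) i j := by
  rcases ht with ⟨rfl, rfl, rfl⟩ | ⟨rfl, rfl, rfl⟩ | ⟨rfl, rfl, rfl⟩ | ⟨rfl, rfl, rfl⟩
  · exact .inl ⟨rfl, rfl, h.2.1 _ hd hd'⟩
  · exact .inr (.inl ⟨rfl, rfl, h.2.1 _ hd' hd⟩)
  · exact .inr (.inr (.inl ⟨rfl, rfl, h.2.2 _ hd hd'⟩))
  · exact .inr (.inr (.inr ⟨rfl, rfl, h.2.2 _ hd' hd⟩))

/-- The flat diagram of a tiling. -/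
noncomputable def tilingDiagram {D : Finset (ℕ × ℕ)} {τ : ℕ × ℕ → T.index}
    (hc : ConnectedRegion D) (h : IsTiling T D τ) : T.Diag where
  size := D.card
  star v := τ (D.equivFin.symm v).1
  link a b := Touch (D.equivFin.symm a.1).1 (D.equivFin.symm b.1).1 a.2 b.2
  link_symm _ _ ht := ht.symm
  link_dual a b ht := dual_of_touch _ _ _ _ (h.1 _ (Subtype.prop _)) (h.1 _ (Subtype.prop _)) ht
    (h.fits (Subtype.prop _) (Subtype.prop _) ht)
  link_injective a b c hb hc := by
    obtain ⟨h1, h2⟩ := hb.unique hc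
    exact Prod.ext (D.equivFin.symm.injective (Subtype.ext h1)) h2
  connected := by
    refine SimpleGraph.Connected.map
      (G := (SimpleGraph.hasse ℕ □ SimpleGraph.hasse ℕ).induce (D : Set (ℕ × ℕ)))
      ⟨fun d => D.equivFin d, fun {d d'} hadj => ?_⟩ D.equivFin.surjective hc
    obtain ⟨i, j, ht⟩ := exists_touch_of_grid_adj hadj
    refine (SimpleGraph.fromRel_adj _ _ _).2 ⟨fun he => hadj.ne ?_, .inl ⟨i, j, ?_⟩⟩
    · exact D.equivFin.injective he
    · simpa using ht

theorem isFlat_tilingDiagram {D : Finset (ℕ × ℕ)} {τ : ℕ × ℕ → T.index}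
    (hc : ConnectedRegion D) (h : IsTiling T D τ) :
    IsFlat (tilingDiagram hc h) (fun v => (D.equivFin.symm v).1) :=
  ⟨isPlacement_iff.2 ⟨fun v => h.1 _ (D.equivFin.symm v).2, fun _ _ _ _ ht => ht⟩,
    fun _ _ e => D.equivFin.symm.injective (Subtype.ext e),
    fun _ _ e => .inl ⟨rfl, rfl, e⟩, fun _ _ e => .inr (.inr (.inl ⟨rfl, rfl, e⟩))⟩

/-- Sending a vertex to one in the same cell preserves links, since touching sides in a flat diagram
are linked. -/
theorem IsFlat.sub {δ η : T.Diag} {p : Fin δ.size → ℕ × ℕ} {q : Fin η.size → ℕ × ℕ}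
    (hp : IsFlat δ p) (hq : IsFlat η q) (hr : Set.range p ⊆ Set.range q)
    {τ : ℕ × ℕ → T.index} (hδ : ∀ v, δ.star v = τ (p v)) (hη : ∀ v, η.star v = τ (q v)) :
    δ.Sub η := by
  choose f hf using fun v => hr (Set.mem_range_self v)
  refine ⟨⟨f, fun u v e => hp.2.1 ?_⟩, fun v => ?_, fun u i v j hl => ?_⟩
  · rw [← hf u, e, hf]
  · exact (hη _).trans ((congrArg τ (hf v)).trans (hδ v).symm)
  · apply hq.link_of_touch
    have := (isPlacement_iff.1 hp.1).2 _ _ _ _ hl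
    rwa [← hf u, ← hf v] at this

/-- Mutual inclusion expresses isomorphism: both diagrams have finitely many vertices and links. -/
theorem exists_flat_diagram {D : Finset (ℕ × ℕ)} {τ : ℕ × ℕ → T.index}
    (hc : ConnectedRegion D) (h : IsTiling T D τ) :
    ∃ (δ : T.Diag) (p : Fin δ.size → ℕ × ℕ), δ.Correct ∧ IsFlat δ p ∧
      Set.range p = D ∧ (∀ v, δ.star v = τ (p v)) ∧
      ∀ (η : T.Diag) (q : Fin η.size → ℕ × ℕ), IsFlat η q → Set.range q = D →
        (∀ v, η.star v = τ (q v)) → η.Sub δ ∧ δ.Sub η := by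
  have hf := isFlat_tilingDiagram hc h
  have hr : Set.range (fun v => (D.equivFin.symm v).1) = D := by
    ext d
    constructor
    · rintro ⟨v, rfl⟩
      exact (D.equivFin.symm v).2
    · exact fun hd => ⟨D.equivFin ⟨d, hd⟩, by simp⟩
  refine ⟨tilingDiagram hc h, _, correct_iff.2 ⟨_, hf.1⟩, hf, hr, fun _ => rfl,
    fun η q hq hrq hη => ⟨hq.sub hf ?_ hη fun _ => rfl, hf.sub hq ?_ (fun _ => rfl) hη⟩⟩
  · exact (hrq.trans hr.symm).subset
  · exact (hr.trans hrq.symm).subset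

theorem IsFlat.exists_tiling {δ : T.Diag} {p : Fin δ.size → ℕ × ℕ} (hp : IsFlat δ p) :
    ∃ (D : Finset (ℕ × ℕ)) (τ : ℕ × ℕ → T.index), ConnectedRegion D ∧ IsTiling T D τ ∧
      Set.range p = D ∧ ∀ v, δ.star v = τ (p v) := by
  have := δ.nonempty_vertices
  let D : Finset (ℕ × ℕ) := Finset.univ.image p
  -- `invFun` inverts `p` on its range because no cell is used twice; its values outside `D` play no
  -- role.
  let τ : ℕ × ℕ → T.index := fun d => δ.star (Function.invFun p d)
  have hτ : ∀ v, δ.star v = τ (p v) := fun v => by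
    simp only [τ, Function.leftInverse_invFun hp.2.1 v]
  have hD : ∀ d ∈ D, ∃ v, p v = d := fun d hd => by simpa [D] using hd
  refine ⟨D, τ, ?_, ⟨fun d hd q hq => ?_, fun d hd hd' => ?_, fun d hd hd' => ?_⟩, by simp [D], hτ⟩
  · refine SimpleGraph.Connected.map (H := (SimpleGraph.hasse ℕ □ SimpleGraph.hasse ℕ).induce
      (D : Set (ℕ × ℕ))) ⟨fun v => ⟨p v, by simp [D]⟩, fun {u v} hadj => ?_⟩ ?_ δ.connected
    · rw [SimpleGraph.fromRel_adj] at hadj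
      rcases hadj.2 with ⟨i, j, hl⟩ | ⟨i, j, hl⟩
      · exact ((isPlacement_iff.1 hp.1).2 _ _ _ _ hl).grid_adj
      · exact ((isPlacement_iff.1 hp.1).2 _ _ _ _ hl).symm.grid_adj
    · rintro ⟨d, hd⟩
      obtain ⟨v, rfl⟩ := hD d hd
      exact ⟨v, rfl⟩
  · obtain ⟨v, rfl⟩ := hD d hd
    exact hp.1.1 v q (by rw [← hq]; exact congrArg T.pin (hτ v))
  · obtain ⟨v, rfl⟩ := hD d hd
    obtain ⟨w, hw⟩ := hD _ hd'
    have := link_fits (hp.2.2.1 v w hw)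
    rw [← hw, ← hτ, ← hτ]
    simpa [Fits, E, W, N, S] using this
  · obtain ⟨v, rfl⟩ := hD d hd
    obtain ⟨w, hw⟩ := hD _ hd'
    have := link_fits (hp.2.2.2 v w hw)
    rw [← hw, ← hτ, ← hτ]
    simpa [Fits, E, W, N, S] using this

end Wang

/-! ### Saturated diagrams are the closed ones -/

namespace Stellar

variable {S : ColouredSignature} {A : Set S.colours} {K : Constellation S}

theorem term_subst_congr {t : S.Term} {θ θ' : ℕ → S.Term} (h : ∀ x ∈ t.varFinset, θ x = θ' x) :
    t.subst θ = t.subst θ' := by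
  induction t with
  | var x => exact h x (by simp [FirstOrder.Language.Term.varFinset])
  | func f ts ih =>
    simp only [FirstOrder.Language.Term.subst]
    congr 1
    funext i
    refine ih i fun x hx => h x ?_
    simp only [FirstOrder.Language.Term.varFinset, Finset.mem_biUnion, Finset.mem_univ, true_and]
    exact ⟨i, hx⟩

theorem subst_relabel (t : S.Term) (α : ℕ → ℕ) (θ : ℕ → S.Term) :
    (t.relabel α).subst θ = t.subst (θ ∘ α) := by
  induction t with
  | var x => rfl
  | func f ts ih =>
    simp only [FirstOrder.Language.Term.subst, FirstOrder.Language.Term.relabel]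
    congr 1
    funext i
    exact ih i

/-- The map `α` need not be injective and cannot be inverted. Instead the variables of `u` are moved
beyond those of `t`, and the new substitution applies `α` first on the variables of `t`. -/
theorem Matchable.symm {t u : S.Term} (h : Matchable t u) : Matchable u t := by
  obtain ⟨α, θ, h⟩ := h
  have h : (t.relabel α).subst θ = u.subst θ := h _ rfl
  -- `m` exceeds every variable of `t`.
  let m := t.varFinset.sup id + 1
  refine ⟨(· + m), fun x => if x < m then θ (α x) else θ (x - m), ?_⟩
  rintro _ rfl
  show (u.relabel _).subst _ = t.subst _
  rw [subst_relabel, ← term_subst_congr (θ := θ), ← h, subst_relabel]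
  · refine term_subst_congr fun x hx => ?_
    have : x < m := Nat.lt_succ_of_le (Finset.le_sup (f := id) hx)
    simp [this]
  · intro x _
    simp

theorem Dual.symm {r s : Ray S} (h : Dual A r s) : Dual A s r := by
  obtain ⟨c, hc, ts, us, h | h, hm⟩ := h
  · exact ⟨c, hc, us, ts, .inr ⟨h.2, h.1⟩, hm.symm⟩
  · exact ⟨c, hc, us, ts, .inl ⟨h.2, h.1⟩, hm.symm⟩

namespace Diagram

/-- No free ray is dual to a ray of the constellation. -/
def Closed (δ : Diagram A K) : Prop :=
  ∀ a ∈ δ.free, ∀ r, δ.HasRay a r → ∀ i, ∀ s ∈ (K.star i).1, ¬ Dual A r s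

/-- The links of the diagram that arises from `δ` by joining the ray occurrence `a` to the
position `k` of a new vertex. -/
inductive ExtendLink (δ : Diagram A K) (a : Fin δ.size × ℕ) (k : ℕ) :
    Fin (δ.size + 1) × ℕ → Fin (δ.size + 1) × ℕ → Prop
  | old (b c : Fin δ.size × ℕ) (h : δ.link b c) :
      ExtendLink δ a k (b.1.castSucc, b.2) (c.1.castSucc, c.2)
  | new : ExtendLink δ a k (a.1.castSucc, a.2) (Fin.last _, k)
  | new' : ExtendLink δ a k (Fin.last _, k) (a.1.castSucc, a.2)

/-- The diagram that arises from `δ` by joining the free ray occurrence `a` to a new vertex. -/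
def extend (δ : Diagram A K) (a : Fin δ.size × ℕ) (ha : a ∈ δ.free) (r s : Ray S)
    (hr : δ.HasRay a r) (i : K.index) (k : ℕ) (hs : (K.star i).1[k]? = some s)
    (hd : Dual A r s) : Diagram A K where
  size := δ.size + 1
  star := Fin.snoc (α := fun _ => K.index) δ.star i
  link := ExtendLink δ a k
  link_symm := by
    rintro _ _ (⟨b, c, h⟩ | _ | _)
    · exact .old _ _ (δ.link_symm _ _ h)
    · exact .new'
    · exact .new
  link_dual := by
    rintro _ _ (⟨b, c, h⟩ | _ | _)
    · simpa using δ.link_dual b c h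
    · exact ⟨r, s, by simpa [HasRay] using hr, by simpa using hs, hd⟩
    · exact ⟨s, r, by simpa using hs, by simpa [HasRay] using hr, hd.symm⟩
  link_injective := by
    have key : ∀ x y z, ExtendLink δ a k x y → ExtendLink δ a k x z → y = z := by
      rintro x y z hy hz
      generalize hx : x = x' at hz
      rcases hy with ⟨b, c, h⟩ | _ | _ <;> rcases hz with ⟨b', c', h'⟩ | _ | _
      · obtain ⟨h1, h2⟩ := Prod.ext_iff.1 hx
        have : b = b' := Prod.ext (Fin.castSucc_injective _ h1) h2
        subst this
        rw [δ.link_injective _ _ _ h h']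
      · obtain ⟨h1, h2⟩ := Prod.ext_iff.1 hx
        have : b = a := Prod.ext (Fin.castSucc_injective _ h1) h2
        exact absurd (this ▸ h) (ha.2 c)
      · exact absurd (Prod.ext_iff.1 hx).1 (Fin.castSucc_lt_last _).ne
      · obtain ⟨h1, h2⟩ := Prod.ext_iff.1 hx
        have : a = b' := Prod.ext (Fin.castSucc_injective _ h1) h2
        exact absurd (this ▸ h') (ha.2 c')
      · rfl
      · exact absurd (Prod.ext_iff.1 hx).1 (Fin.castSucc_lt_last _).ne
      · exact absurd (Prod.ext_iff.1 hx).1 (Fin.castSucc_lt_last _).ne'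
      · exact absurd (Prod.ext_iff.1 hx).1 (Fin.castSucc_lt_last _).ne'
      · rfl
    exact key
  connected := by
    have hr : ∀ v, (SimpleGraph.fromRel fun u v => ∃ i j, ExtendLink δ a k (u, i) (v, j)).Reachable
        a.1.castSucc v := by
      intro v
      refine Fin.lastCases ?_ (fun v => ?_) v
      · refine SimpleGraph.Adj.reachable ((SimpleGraph.fromRel_adj _ _ _).2
          ⟨(Fin.castSucc_lt_last _).ne, .inl ⟨_, _, .new⟩⟩)
      · refine δ.link_induction (P := fun v => SimpleGraph.Reachable _ a.1.castSucc v.castSucc)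
          (fun u i v j hl hu => ?_) (SimpleGraph.Reachable.refl _) v
        by_cases huv : u = v
        · exact huv ▸ hu
        · refine hu.trans (SimpleGraph.Adj.reachable ((SimpleGraph.fromRel_adj _ _ _).2
            ⟨fun h => huv (Fin.castSucc_injective _ h), .inl ⟨i, j, .old (u, i) (v, j) hl⟩⟩))
    exact { preconnected := fun u v => (hr u).symm.trans (hr v), nonempty := ⟨a.1.castSucc⟩ }

/-- A dual ray would allow a diagram with one more vertex, too large to be embedded back. Whether
that extension is correct is irrelevant, as saturation compares with all diagrams. -/
theorem Saturated.closed {δ : Diagram A K} (h : δ.Saturated) : δ.Closed := by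
  intro a ha r hr i s hs hd
  obtain ⟨k, hk⟩ := List.mem_iff_getElem?.1 hs
  obtain ⟨f, -⟩ := h (δ.extend a ha r s hr i k hk hd)
    ⟨Fin.castSuccEmb, fun v => Fin.snoc_castSucc (α := fun _ => K.index) _ _ v,
      fun u i v j hl => .old (u, i) (v, j) hl⟩
  have := Fintype.card_le_of_embedding f
  rw [Fintype.card_fin, Fintype.card_fin] at this
  exact absurd this (Nat.not_succ_le_self _)

/-- The image of a closed diagram in a larger one absorbs all links that meet it, so by
connectedness it is everything. -/
theorem Closed.saturated {δ : Diagram A K} (h : δ.Closed) : δ.Saturated := by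
  rintro η ⟨f, hf, hl⟩
  -- A link of `η` at the image comes from `δ`: a free ray of `δ` there would be dual to the ray at
  -- the other end, and a used one has no room for a second link.
  have hback : ∀ u i w j, η.link (f u, i) (w, j) → ∃ v, f v = w ∧ δ.link (u, i) (v, j) := by
    intro u i w j hη
    obtain ⟨r, s, hr, hs, hd⟩ := η.link_dual _ _ hη
    have hr' : δ.HasRay (u, i) r := by
      unfold HasRay
      rw [← hf]
      exact hr
    by_cases hfree : (u, i) ∈ δ.free
    · exact absurd hd (h _ hfree r hr' _ s (List.mem_iff_getElem?.2 ⟨_, hs⟩))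
    · have : ∃ b, δ.link (u, i) b := by
        by_contra! hb
        exact hfree ⟨⟨r, hr'⟩, hb⟩
      obtain ⟨⟨v, j'⟩, hv⟩ := this
      have := η.link_injective _ _ _ hη (hl _ _ _ _ hv)
      rw [Prod.mk.injEq] at this
      obtain ⟨rfl, rfl⟩ := this
      exact ⟨v, rfl, hv⟩
  obtain ⟨u₀⟩ := δ.nonempty_vertices
  have hsurj : ∀ w, ∃ v, f v = w := η.link_induction (P := fun w => ∃ v, f v = w)
    (fun w i w' j hη hw => by
      obtain ⟨u, rfl⟩ := hw
      obtain ⟨v, hv, -⟩ := hback _ _ _ _ hη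
      exact ⟨v, hv⟩) ⟨u₀, rfl⟩
  choose g hg using hsurj
  have hstar : ∀ w, δ.star (g w) = η.star w := fun w => by rw [← hf, hg]
  have hlink : ∀ w i w' j, η.link (w, i) (w', j) → δ.link (g w, i) (g w', j) := by
    intro w i w' j hη
    rw [← hg w] at hη
    obtain ⟨v, hv, hv'⟩ := hback _ _ _ _ hη
    rw [← hg w'] at hv
    exact f.injective hv ▸ hv'
  exact ⟨⟨g, (Function.LeftInverse.injective (g := f) hg)⟩, hstar, hlink⟩

end Diagram

end Stellar

/-! ### Neighbours forced by closedness -/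

namespace Wang

open Stellar

variable {C : Type} [Countable C] {T : TileSet C} {δ : T.Diag}

theorem openToNorthOnly_of_closed (h : δ.Closed) : OpenToNorthOnly δ :=
  fun a ha r hr ⟨i, s, hs, hd⟩ => absurd hd (h a ha r hr i s hs)

/-- A side that fits a side of an unpinned tile is linked unless it may stay open. -/
theorem exists_link {v : Fin δ.size} {k l : ℕ} {i : T.index} (d d' : ℕ × ℕ)
    (hv : ∀ q, T.pin (δ.star v) = some q → d = q) (hi : T.pin i = none) (ht : Touch d d' k l)
    (hf : Fits (T.tile (δ.star v)) (T.tile i) k l)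
    (hopen : ∀ r, δ.HasRay (v, k) r → (∃ i, ∃ s ∈ (T.constellation.star i).1, Dual Set.univ r s) →
      (v, k) ∉ δ.free) : ∃ u j, δ.link (v, k) (u, j) := by
  obtain ⟨r, s, hr, hs, hd⟩ := dual_of_touch (δ.star v) i d d' hv (by simp [hi]) ht hf
  by_contra! h
  exact hopen r hr ⟨i, s, List.mem_iff_getElem?.2 ⟨_, hs⟩, hd⟩ ⟨⟨r, hr⟩, fun b => h b.1 b.2⟩

variable {p : Fin δ.size → ℕ × ℕ}

theorem exists_west_neighbour (hp : IsPlacement δ p) (hO : OpenToNorthOnly δ) {v : Fin δ.size}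
    (hv : T.pin (δ.star v) = none) {i : T.index} (hi : T.pin i = none)
    (h : (T.tile i).east = (T.tile (δ.star v)).west) :
    ∃ u, p v = p u + (1, 0) ∧ (T.tile (δ.star u)).east = (T.tile (δ.star v)).west := by
  -- Both tiles are unpinned, so any two adjacent cells witness the duality. The cell `p v` itself
  -- would not do, as it might have no western neighbour in ℕ²; that it has one is part of the
  -- conclusion.
  obtain ⟨u, j, hl⟩ := exists_link (k := W) (l := E) (i := i) (1, 0) (0, 0) (by simp [hv]) hi
    (.inr (.inl ⟨rfl, rfl, rfl⟩)) (.inr (.inl ⟨rfl, rfl, h⟩))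
    (fun r hr hd hf => absurd (hO _ hf r hr hd) (by simp [W, N]))
  have := hp.2 _ _ _ _ hl
  simp [W, E, N, S] at this
  exact ⟨u, this.2⟩

theorem exists_south_neighbour (hp : IsPlacement δ p) (hO : OpenToNorthOnly δ) {v : Fin δ.size}
    (hv : T.pin (δ.star v) = none) {i : T.index} (hi : T.pin i = none)
    (h : (T.tile i).north = (T.tile (δ.star v)).south) :
    ∃ u, p v = p u + (0, 1) ∧ (T.tile (δ.star u)).north = (T.tile (δ.star v)).south := by
  obtain ⟨u, j, hl⟩ := exists_link (k := S) (l := N) (i := i) (0, 1) (0, 0) (by simp [hv]) hi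
    (.inr (.inr (.inr ⟨rfl, rfl, rfl⟩))) (.inr (.inr (.inr ⟨rfl, rfl, h⟩)))
    (fun r hr hd hf => absurd (hO _ hf r hr hd) (by simp [S, N]))
  have := hp.2 _ _ _ _ hl
  simp [W, E, N, S] at this
  exact ⟨u, this.2⟩

theorem exists_east_neighbour (hp : IsPlacement δ p) (hO : OpenToNorthOnly δ) {v : Fin δ.size}
    (hv : T.pin (δ.star v) = none) {i : T.index} (hi : T.pin i = none)
    (h : (T.tile (δ.star v)).east = (T.tile i).west) :
    ∃ u, p u = p v + (1, 0) ∧ (T.tile (δ.star v)).east = (T.tile (δ.star u)).west := by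
  obtain ⟨u, j, hl⟩ := exists_link (k := E) (l := W) (i := i) (0, 0) (1, 0) (by simp [hv]) hi
    (.inl ⟨rfl, rfl, rfl⟩) (.inl ⟨rfl, rfl, h⟩)
    (fun r hr hd hf => absurd (hO _ hf r hr hd) (by simp [E, N]))
  have := hp.2 _ _ _ _ hl
  simp [W, E, N, S] at this
  exact ⟨u, this.2⟩

theorem exists_north_neighbour (hp : IsPlacement δ p) (hC : δ.Closed) {v : Fin δ.size}
    {i : T.index} (hi : T.pin i = none) (h : (T.tile (δ.star v)).north = (T.tile i).south) :
    ∃ u, p u = p v + (0, 1) ∧ (T.tile (δ.star v)).north = (T.tile (δ.star u)).south := by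
  -- To the north there is always a cell, so the actual position can be used and `v` may be pinned.
  obtain ⟨u, j, hl⟩ := exists_link (k := N) (l := S) (i := i) (p v) (p v + (0, 1)) (hp.1 v) hi
    (.inr (.inr (.inl ⟨rfl, rfl, rfl⟩))) (.inr (.inr (.inl ⟨rfl, rfl, h⟩)))
    (fun r hr ⟨i, s, hs, hd⟩ hf => hC _ hf r hr i s hs hd)
  have := hp.2 _ _ _ _ hl
  simp [W, E, N, S] at this
  exact ⟨u, this.2⟩

end Wang

/-! ### Colours and tiles of the simulation -/

namespace RightTM

open Wang

variable {Q Γ : Type}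

section Colours

/-- The side colours of the simulation, where `K` is the type of cell contents. -/
inductive Colour (K : Type) : Type
  | low
  | high
  | leftGuard
  | rightGuard
  | input
  | blank
  | row (halted : Bool) (a b : K)
  | cell (first last : Bool) (b : K)
  | result (b : K)

instance (K : Type) [Finite K] : Finite (Colour K) := by
  let g : (Fin 6 ⊕ (Bool × K × K)) ⊕ ((Bool × Bool × K) ⊕ K) → Colour K := fun x => match x with
    | .inl (.inl 0) => .low
    | .inl (.inl 1) => .high
    | .inl (.inl 2) => .leftGuard
    | .inl (.inl 3) => .rightGuard
    | .inl (.inl 4) => .input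
    | .inl (.inl 5) => .blank
    | .inl (.inr (m, a, b)) => .row m a b
    | .inr (.inl (l, r, b)) => .cell l r b
    | .inr (.inr b) => .result b
  have hg : Function.Surjective g := by
    rintro (_ | _ | _ | _ | _ | _ | ⟨m, a, b⟩ | ⟨l, r, b⟩ | b)
    · exact ⟨.inl (.inl 0), rfl⟩
    · exact ⟨.inl (.inl 1), rfl⟩
    · exact ⟨.inl (.inl 2), rfl⟩
    · exact ⟨.inl (.inl 3), rfl⟩
    · exact ⟨.inl (.inl 4), rfl⟩
    · exact ⟨.inl (.inl 5), rfl⟩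
    · exact ⟨.inl (.inr (m, a, b)), rfl⟩
    · exact ⟨.inr (.inl (l, r, b)), rfl⟩
    · exact ⟨.inr (.inr b), rfl⟩
  exact Finite.of_surjective g hg

/-- The content shown by a colour. -/
def Colour.content {K : Type} (d : K) : Colour K → K
  | .cell _ _ b => b
  | .result b => b
  | _ => d

/-- `low` must stay unmatched: it marks the sides that may remain open to the west and to the south.
-/
def Colour.notLow {K : Type} : Colour K → Colour K
  | .low => .leftGuard
  | c => c

/-- `high` marks the eastern border and `result` the northern sides of a halting row; no guard may
fit them. -/
def Colour.notHigh {K : Type} : Colour K → Colour K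
  | .high => .rightGuard
  | .result _ => .rightGuard
  | c => c

end Colours

/-- Renaming of the colours of a tile. -/
def mapTile {C D : Type} (f : C → D) (t : Tile C) : Tile D :=
  ⟨f t.west, f t.east, f t.south, f t.north⟩

namespace Machine

variable (M : Machine Q Γ)

/-- The state that enters a cell from the west, given the content of the cell to the west. -/
def fromWest : Option (Γ × Option Q) → Option Q
  | some (s, some q) => match M.trans q s with
    | some (q', _, .right) => some q'
    | _ => none
  | _ => none

/-- The state that enters a cell from the east, given the content of the cell to the east. -/
def fromEast : Option (Γ × Option Q) → Option Q
  | some (s, some q) => match M.trans q s with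
    | some (q', _, .left) => some q'
    | _ => none
  | _ => none

/-- The next content of a cell with content `b` between cells with contents `a` and `c`. -/
def next (a : Option (Γ × Option Q)) (b : Γ × Option Q) (c : Option (Γ × Option Q)) :
    Γ × Option Q :=
  match b.2 with
  | some q => match M.trans q b.1 with
    | some (q', s, .stay) => (s, some q')
    | some (q', s, .left) => (s, if a.isNone then some q' else none)
    | some (_, s, .right) => (s, none)
    | none => b
  | none => (b.1, (M.fromWest a).or (M.fromEast c))

/-- The conditions on a tile for a cell that carries the head: it knows whether the machine halts,
and the head does not leave the region to the east. -/
def Valid (m : Bool) (b : Γ × Option Q) (c : Option (Γ × Option Q)) : Prop :=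
  ∀ q, b.2 = some q → (m = true ↔ M.trans q b.1 = none) ∧
    (c = none → ∀ q' s, M.trans q b.1 ≠ some (q', s, .right))

/-- The tile of a cell with content `b` between cells with contents `a` and `c`; the absence of
`a` or `c` means that the cell is at the border of the region. -/
def cellTile (m : Bool) (a : Option (Γ × Option Q)) (b : Γ × Option Q)
    (c : Option (Γ × Option Q)) : Tile (Colour (Γ × Option Q)) where
  west := a.elim .low fun a => .row m a b
  east := c.elim .high fun c => .row m b c
  south := .cell a.isNone c.isNone b
  north := if m then .result b else .cell a.isNone c.isNone (M.next a b c)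

/-- The tile of a blank cell to the right of the input in the bottom row. -/
def blankTile (last : Bool) : Tile (Colour (Γ × Option Q)) where
  west := .blank
  east := if last then .high else .blank
  south := .low
  north := .cell false last (M.blank, none)

/-- The tile of an input cell with content `b`. -/
def inputTile (b : Γ × Option Q) (last : Bool) : Tile (Colour (Γ × Option Q)) where
  west := if b.2.isSome then .low else .input
  east := if last then .blank else .input
  south := .low
  north := .cell b.2.isSome false b

/-- A tile that never occurs in a diagram without open western sides. -/
def westGuard {K : Type} (c : Colour K) : Tile (Colour K) := ⟨.leftGuard, c.notLow, .leftGuard, c.notLow⟩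

/-- A tile that never occurs in a diagram without open eastern sides. -/
def eastGuard {K : Type} (c : Colour K) : Tile (Colour K) := ⟨c.notHigh, .rightGuard, c.notHigh, .rightGuard⟩

/-- Names of the program tiles. -/
abbrev TileName (K : Type) : Type :=
  (Bool ⊕ (Bool × Option K × K × Option K)) ⊕ (Colour K ⊕ Colour K)

-- Parameters that are not `Valid` are given a guard, which occurs in no diagram that is open to the
-- north only.
open Classical in
noncomputable def program : TileName (Γ × Option Q) → Tile (Colour (Γ × Option Q))
  | .inl (.inl e) => M.blankTile e
  | .inl (.inr (m, a, b, c)) => if M.Valid m b c then M.cellTile m a b c else westGuard .low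
  | .inr (.inl c) => westGuard c
  | .inr (.inr c) => eastGuard c

/-- The tile set of the machine `M` on input `w`, where `col` and `idx` enumerate the colours and
the program tiles. -/
noncomputable def simulation {C : Type} {k : ℕ} (col : Colour (Γ × Option Q) ≃ C)
    (idx : Fin k ≃ TileName (Γ × Option Q)) (w : List Γ) : TileSet C :=
  M.tileSet (fun t => mapTile col (M.program (idx t))) (fun b => mapTile col (inputTile b false))
    (fun b => mapTile col (inputTile b true)) w

/-- The tiles of `simulation` before the enumeration of colours. -/
noncomputable def colourTile {k : ℕ} (idx : Fin k ≃ TileName (Γ × Option Q)) (w : List Γ) :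
    Fin k ⊕ Fin (w.length + 1) → Tile (Colour (Γ × Option Q)) :=
  Sum.elim (fun t => M.program (idx t))
    fun i => inputTile ((M.init w).cell i) (decide ((i : ℕ) = w.length))

section Tiles

variable {M} {C : Type} {k : ℕ} (col : Colour (Γ × Option Q) ≃ C)
  (idx : Fin k ≃ TileName (Γ × Option Q)) (w : List Γ)

theorem simulation_tile (i : Fin k ⊕ Fin (w.length + 1)) :
    (M.simulation col idx w).tile i = mapTile col (M.colourTile idx w i) := by
  rcases i with t | i
  · rfl
  · simp only [simulation, tileSet, colourTile, Sum.elim_inr]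
    split <;> simp_all

theorem simulation_pin_inl (t : Fin k) : (M.simulation col idx w).pin (Sum.inl t) = none := rfl

theorem simulation_pin_inr (i : Fin (w.length + 1)) :
    (M.simulation col idx w).pin (Sum.inr i) = some ((i : ℕ), 0) := rfl

theorem program_cases (t : TileName (Γ × Option Q)) :
    (∃ e, M.program t = M.blankTile e) ∨
    (∃ m a b c, M.Valid m b c ∧ M.program t = M.cellTile m a b c) ∨
    (∃ c, M.program t = westGuard c) ∨ (∃ c, M.program t = eastGuard c) := by
  rcases t with (e | ⟨m, a, b, c⟩) | (c | c)
  · exact .inl ⟨e, rfl⟩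
  · by_cases h : M.Valid m b c
    · exact .inr (.inl ⟨m, a, b, c, h, by simp [program, h]⟩)
    · exact .inr (.inr (.inl ⟨.low, by simp [program, h]⟩))
  · exact .inr (.inr (.inl ⟨c, rfl⟩))
  · exact .inr (.inr (.inr ⟨c, rfl⟩))

variable {idx w}

theorem colourTile_cases (i : Fin k ⊕ Fin (w.length + 1)) :
    (∃ b e, M.colourTile idx w i = inputTile b e) ∨
    (∃ e, M.colourTile idx w i = M.blankTile e) ∨
    (∃ m a b c, M.Valid m b c ∧ M.colourTile idx w i = M.cellTile m a b c) ∨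
    (∃ c, M.colourTile idx w i = westGuard c) ∨ (∃ c, M.colourTile idx w i = eastGuard c) := by
  rcases i with t | i
  · exact .inr (program_cases (idx t))
  · exact .inl ⟨_, _, rfl⟩

/-- Only western guards show `leftGuard` to the east, so this colour runs west for ever once it
occurs. -/
theorem west_of_east_eq_leftGuard {i : Fin k ⊕ Fin (w.length + 1)}
    (h : (M.colourTile idx w i).east = .leftGuard) :
    (M.colourTile idx w i).west = .leftGuard := by
  rcases colourTile_cases (M := M) (idx := idx) i with ⟨b, e, hi⟩ | ⟨e, hi⟩ |
    ⟨m, a, b, c, -, hi⟩ | ⟨c, hi⟩ | ⟨c, hi⟩ <;> rw [hi] at h ⊢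
  · cases e <;> simp [inputTile] at h
  · cases e <;> simp [blankTile] at h
  · cases c <;> simp [cellTile] at h
  · rfl
  · simp [eastGuard] at h

theorem east_of_west_eq_rightGuard {i : Fin k ⊕ Fin (w.length + 1)}
    (h : (M.colourTile idx w i).west = .rightGuard) :
    (M.colourTile idx w i).east = .rightGuard := by
  rcases colourTile_cases (M := M) (idx := idx) i with ⟨b, e, hi⟩ | ⟨e, hi⟩ |
    ⟨m, a, b, c, -, hi⟩ | ⟨c, hi⟩ | ⟨c, hi⟩ <;> rw [hi] at h ⊢
  · simp only [inputTile] at h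
    split at h <;> simp at h
  · simp [blankTile] at h
  · cases a <;> simp [cellTile] at h
  · simp [westGuard] at h
  · rfl

/-- This and the next three facts make the borders safe: a side coloured `low`, `high` or `result`
at its border faces no possible partner. -/
theorem east_ne_low (i : Fin k ⊕ Fin (w.length + 1)) : (M.colourTile idx w i).east ≠ .low := by
  rcases colourTile_cases (M := M) (idx := idx) i with ⟨b, e, hi⟩ | ⟨e, hi⟩ |
    ⟨m, a, b, c, -, hi⟩ | ⟨c, hi⟩ | ⟨c, hi⟩ <;> rw [hi]
  · cases e <;> simp [inputTile]
  · cases e <;> simp [blankTile]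
  · cases c <;> simp [cellTile]
  · cases c <;> simp [westGuard, Colour.notLow]
  · simp [eastGuard]

theorem west_ne_high (i : Fin k ⊕ Fin (w.length + 1)) : (M.colourTile idx w i).west ≠ .high := by
  rcases colourTile_cases (M := M) (idx := idx) i with ⟨b, e, hi⟩ | ⟨e, hi⟩ |
    ⟨m, a, b, c, -, hi⟩ | ⟨c, hi⟩ | ⟨c, hi⟩ <;> rw [hi]
  · simp only [inputTile]
    split <;> simp
  · simp [blankTile]
  · cases a <;> simp [cellTile]
  · simp [westGuard]
  · cases c <;> simp [eastGuard, Colour.notHigh]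

theorem north_ne_low (i : Fin k ⊕ Fin (w.length + 1)) : (M.colourTile idx w i).north ≠ .low := by
  rcases colourTile_cases (M := M) (idx := idx) i with ⟨b, e, hi⟩ | ⟨e, hi⟩ |
    ⟨m, a, b, c, -, hi⟩ | ⟨c, hi⟩ | ⟨c, hi⟩ <;> rw [hi]
  · simp [inputTile]
  · simp [blankTile]
  · cases m <;> simp [cellTile]
  · cases c <;> simp [westGuard, Colour.notLow]
  · simp [eastGuard]

theorem south_ne_result (i : Fin k ⊕ Fin (w.length + 1)) (b : Γ × Option Q) :
    (M.colourTile idx w i).south ≠ .result b := by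
  rcases colourTile_cases (M := M) (idx := idx) i with ⟨b, e, hi⟩ | ⟨e, hi⟩ |
    ⟨m, a, b, c, -, hi⟩ | ⟨c, hi⟩ | ⟨c, hi⟩ <;> rw [hi]
  · simp [inputTile]
  · simp [blankTile]
  · simp [cellTile]
  · simp [westGuard]
  · cases c <;> simp [eastGuard, Colour.notHigh]

end Tiles

/-! ### Runs of the machine and the local rule -/

section Runs

variable {M}

/-- The content of the cell to the west of cell `i`. -/
noncomputable def _root_.RightTM.Config.west (c : Config Q Γ) (i : ℕ) : Option (Γ × Option Q) :=
  if i = 0 then none else some (c.cell (i - 1))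

theorem _root_.RightTM.Config.cell_head (c : Config Q Γ) :
    c.cell c.head = (c.tape c.head, some c.state) := by simp [Config.cell]

theorem _root_.RightTM.Config.cell_of_ne {c : Config Q Γ} {i : ℕ} (h : c.head ≠ i) :
    c.cell i = (c.tape i, none) := by simp [Config.cell, h]

theorem step_eq_none_iff {c : Config Q Γ} :
    M.step c = none ↔ M.trans c.state (c.tape c.head) = none := by
  simp [step]

theorem step_eq_some {c c' : Config Q Γ} (h : M.step c = some c') :
    ∃ q s mv, M.trans c.state (c.tape c.head) = some (q, s, mv) ∧
      c' = ⟨q, mv.apply c.head, Function.update c.tape c.head s⟩ := by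
  simp only [step, Option.map_eq_some_iff] at h
  obtain ⟨⟨q, s, mv⟩, h, rfl⟩ := h
  exact ⟨q, s, mv, h, rfl⟩

theorem fromWest_cell {c : Config Q Γ} {i : ℕ} (h : c.head ≠ i) :
    M.fromWest (some (c.cell i)) = none := by
  rw [Config.cell_of_ne h]; rfl

theorem fromEast_cell {c : Config Q Γ} {i : ℕ} (h : c.head ≠ i) :
    M.fromEast (some (c.cell i)) = none := by
  rw [Config.cell_of_ne h]; rfl

-- The head moves by at most one cell, so three neighbouring contents determine the next one. In the
-- last column the eastern content may be missing, because with the head at or west of `i` nothing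
-- can enter from the east.
open Classical in
theorem next_eq_cell {c c' : Config Q Γ} (h : M.step c = some c') {i : ℕ}
    {e : Option (Γ × Option Q)} (he : e = some (c.cell (i + 1)) ∨ e = none ∧ c.head ≤ i) :
    M.next (c.west i) (c.cell i) e = c'.cell i := by
  obtain ⟨q, s, mv, ht, rfl⟩ := step_eq_some h
  by_cases hi : c.head = i
  · subst hi
    rw [Config.cell_head]
    rcases mv with _ | _ | _ <;> simp [next, ht, Config.cell, Move.apply, Config.west]
    -- Only the left move is not settled by computation: it keeps the head in place on cell 0 and
    -- takes it away elsewhere.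
    rcases Nat.eq_zero_or_pos c.head with h0 | h0
    · simp [h0]
    · have h1 : c.head - 1 ≠ c.head := by omega
      simp [h0.ne', h1]
  · have hW : M.fromWest (c.west i) = if i = c.head + 1 ∧ mv = .right then some q else none := by
      unfold Config.west
      by_cases hi' : i = c.head + 1
      · subst hi'
        rw [if_neg (by omega), Nat.add_sub_cancel, Config.cell_head]
        cases mv <;> simp [fromWest, ht]
      · rw [if_neg (c := _ ∧ _) (fun h => hi' h.1)]
        split
        · rfl
        · exact fromWest_cell (by omega)
    have hE : M.fromEast e = if c.head = i + 1 ∧ mv = .left then some q else none := by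
      rcases he with rfl | ⟨rfl, he⟩
      · by_cases hi' : c.head = i + 1
        · rw [← hi', Config.cell_head]
          cases mv <;> simp [fromEast, ht]
        · rw [if_neg (by tauto)]
          exact fromEast_cell hi'
      · rw [if_neg (by omega)]; rfl
    rw [Config.cell_of_ne hi]
    simp only [next, hW, hE, Config.cell, Function.update_of_ne (Ne.symm hi)]
    congr 1
    rcases mv with _ | _ | _ <;> simp only [Move.apply]
    · by_cases hi' : c.head = i + 1
      · simp [hi']
      · have h1 : c.head - 1 ≠ i := by omega
        simp [hi', h1]
    · by_cases hi' : i = c.head + 1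
      · simp [hi']
      · have h1 : c.head + 1 ≠ i := by omega
        simp [hi', h1]
    · simp [hi]

theorem run_succ {w : List Γ} {n : ℕ} {c : Config Q Γ} (h : M.run w n = some c) :
    M.run w (n + 1) = M.step c := by
  simp [run, h]

theorem run_isSome_of_le {w : List Γ} {m n : ℕ} (hmn : m ≤ n) (h : (M.run w n).isSome) :
    (M.run w m).isSome := by
  induction n, hmn using Nat.le_induction with
  | base => exact h
  | succ n _ ih =>
    apply ih
    rcases hn : M.run w n with _ | c
    · simp [run, hn] at h
    · rfl

theorem halting_unique {w : List Γ} {m n : ℕ} {c d : Config Q Γ} (hm : M.run w m = some c)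
    (hn : M.run w n = some d) (hc : M.step c = none) (hd : M.step d = none) :
    m = n ∧ c = d := by
  have key : ∀ {m n : ℕ} {c d : Config Q Γ}, M.run w m = some c → M.run w n = some d →
      M.step c = none → n ≤ m := by
    intro m n c d hm hn hc
    by_contra! hlt
    have := run_isSome_of_le (M := M) (w := w) (show m + 1 ≤ n from hlt) (by simp [hn])
    simp [run_succ hm, hc] at this
  have : m = n := le_antisymm (key hn hm hd) (key hm hn hc)
  subst this
  exact ⟨rfl, Option.some.inj (hm.symm.trans hn)⟩

/-- Bounds the columns that a space-time diagram needs. -/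
theorem head_le {w : List Γ} {n : ℕ} {c : Config Q Γ} (h : M.run w n = some c) : c.head ≤ n := by
  induction n generalizing c with
  | zero =>
    simp only [run, Option.some.injEq] at h
    subst h
    rfl
  | succ n ih =>
    rcases hn : M.run w n with _ | d
    · simp [run, hn] at h
    · rw [run_succ hn] at h
      obtain ⟨q, s, mv, -, rfl⟩ := step_eq_some h
      have := ih hn
      cases mv <;> simp only [Move.apply] <;> omega

end Runs

end Machine

end RightTM

/-! ### Diagrams open to the north only show the run -/

namespace RightTM.Machine

open Wang Stellar

variable {Q Γ : Type} {M : Machine Q Γ} {C : Type} [Countable C] {k : ℕ}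
  {col : Colour (Γ × Option Q) ≃ C} {idx : Fin k ≃ TileName (Γ × Option Q)} {w : List Γ}

/-- The tile at a vertex, before the enumeration of colours. -/
noncomputable def tileAt (δ : (M.simulation col idx w).Diag) (v : Fin δ.size) :
    Tile (Colour (Γ × Option Q)) :=
  M.colourTile idx w (δ.star v)

/-- The pin of the tile at a vertex. -/
noncomputable def pinAt (δ : (M.simulation col idx w).Diag) (v : Fin δ.size) : Option (ℕ × ℕ) :=
  (M.simulation col idx w).pin (δ.star v)

variable {δ : (M.simulation col idx w).Diag} {p : Fin δ.size → ℕ × ℕ}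

theorem tile_star (v : Fin δ.size) :
    (M.simulation col idx w).tile (δ.star v) = mapTile col (tileAt δ v) :=
  simulation_tile col idx w (δ.star v)

theorem tileAt_cases (v : Fin δ.size) :
    (∃ i : ℕ, i ≤ w.length ∧ pinAt δ v = some (i, 0) ∧
      tileAt δ v = inputTile ((M.init w).cell i) (decide (i = w.length))) ∨
    (pinAt δ v = none ∧ ((∃ e, tileAt δ v = M.blankTile e) ∨
    (∃ m a b c, M.Valid m b c ∧ tileAt δ v = M.cellTile m a b c) ∨
    (∃ c, tileAt δ v = westGuard c) ∨ (∃ c, tileAt δ v = eastGuard c))) := by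
  have key : ∀ s : Fin k ⊕ Fin (w.length + 1),
      (∃ i : ℕ, i ≤ w.length ∧ (M.simulation col idx w).pin s = some (i, 0) ∧
        M.colourTile idx w s = inputTile ((M.init w).cell i) (decide (i = w.length))) ∨
      ((M.simulation col idx w).pin s = none ∧ ((∃ e, M.colourTile idx w s = M.blankTile e) ∨
      (∃ m a b c, M.Valid m b c ∧ M.colourTile idx w s = M.cellTile m a b c) ∨
      (∃ c, M.colourTile idx w s = westGuard c) ∨ (∃ c, M.colourTile idx w s = eastGuard c))) := by
    rintro (t | i)
    · exact .inr ⟨rfl, program_cases (idx t)⟩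
    · exact .inl ⟨i, Nat.le_of_lt_succ i.2, rfl, rfl⟩
  exact key (δ.star v)

/-- The western guard of this colour is a candidate for the neighbour, so the side is dual to some
ray and cannot be free. The tile found there may be a different one. -/
theorem exists_west (hp : IsPlacement δ p) (hO : OpenToNorthOnly δ) {v : Fin δ.size}
    (hv : pinAt δ v = none) (h : (tileAt δ v).west ≠ .low) :
    ∃ u, p v = p u + (1, 0) ∧ (tileAt δ u).east = (tileAt δ v).west := by
  obtain ⟨u, hu, he⟩ := exists_west_neighbour hp hO hv
    (i := Sum.inl (idx.symm (.inr (.inl (tileAt δ v).west)))) rfl (by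
      rw [tile_star, simulation_tile]
      refine congrArg col ?_
      simp only [colourTile, Sum.elim_inl, Equiv.apply_symm_apply, program, westGuard]
      generalize (tileAt δ v).west = c at h
      cases c <;> first | exact absurd rfl h | rfl)
  rw [tile_star, tile_star] at he
  exact ⟨u, hu, col.injective he⟩

theorem exists_south (hp : IsPlacement δ p) (hO : OpenToNorthOnly δ) {v : Fin δ.size}
    (hv : pinAt δ v = none) (h : (tileAt δ v).south ≠ .low) :
    ∃ u, p v = p u + (0, 1) ∧ (tileAt δ u).north = (tileAt δ v).south := by
  obtain ⟨u, hu, he⟩ := exists_south_neighbour hp hO hv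
    (i := Sum.inl (idx.symm (.inr (.inl (tileAt δ v).south)))) rfl (by
      rw [tile_star, simulation_tile]
      refine congrArg col ?_
      simp only [colourTile, Sum.elim_inl, Equiv.apply_symm_apply, program, westGuard]
      generalize (tileAt δ v).south = c at h
      cases c <;> first | exact absurd rfl h | rfl)
  rw [tile_star, tile_star] at he
  exact ⟨u, hu, col.injective he⟩

/-- The fixed-point hypothesis excludes `high` and `result`, the colours without an eastern guard.
-/
theorem exists_east (hp : IsPlacement δ p) (hO : OpenToNorthOnly δ) {v : Fin δ.size}
    (hv : pinAt δ v = none) (h : (tileAt δ v).east.notHigh = (tileAt δ v).east) :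
    ∃ u, p u = p v + (1, 0) ∧ (tileAt δ v).east = (tileAt δ u).west := by
  obtain ⟨u, hu, he⟩ := exists_east_neighbour hp hO hv
    (i := Sum.inl (idx.symm (.inr (.inr (tileAt δ v).east)))) rfl (by
      rw [tile_star, simulation_tile]
      refine congrArg col ?_
      simp only [colourTile, Sum.elim_inl, Equiv.apply_symm_apply, program, eastGuard]
      exact h.symm)
  rw [tile_star, tile_star] at he
  exact ⟨u, hu, col.injective he⟩

theorem exists_north (hp : IsPlacement δ p) (hC : δ.Closed) {v : Fin δ.size}
    (h : (tileAt δ v).north.notHigh = (tileAt δ v).north) :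
    ∃ u, p u = p v + (0, 1) ∧ (tileAt δ v).north = (tileAt δ u).south := by
  obtain ⟨u, hu, he⟩ := exists_north_neighbour hp hC (v := v)
    (i := Sum.inl (idx.symm (.inr (.inr (tileAt δ v).north)))) rfl (by
      rw [tile_star, simulation_tile]
      refine congrArg col ?_
      simp only [colourTile, Sum.elim_inl, Equiv.apply_symm_apply, program, eastGuard]
      exact h.symm)
  rw [tile_star, tile_star] at he
  exact ⟨u, hu, col.injective he⟩

/-- Infinite descent: a tile with `leftGuard` on its west side needs another one in the column
before it. -/
theorem not_westGuard (hp : IsPlacement δ p) (hO : OpenToNorthOnly δ) (v : Fin δ.size) :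
    (tileAt δ v).west ≠ .leftGuard := by
  induction hn : (p v).1 using Nat.strong_induction_on generalizing v with
  | _ n ih =>
    intro h
    have hv : pinAt δ v = none := by
      rcases tileAt_cases v with ⟨i, -, -, hi⟩ | h'
      · rw [hi] at h
        simp only [inputTile] at h
        split at h <;> simp at h
      · exact h'.1
    obtain ⟨u, hu, he⟩ := exists_west hp hO hv (by simp [h])
    exact ih (p u).1 (by simp [← hn, hu]) u rfl (west_of_east_eq_leftGuard (he.trans h))

/-- Columns are unbounded to the east, so here finiteness of the diagram is used: an easternmost
offender needs another one further east. -/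
theorem not_eastGuard (hp : IsPlacement δ p) (hO : OpenToNorthOnly δ) (v : Fin δ.size) :
    (tileAt δ v).east ≠ .rightGuard := by
  intro h
  have : Nonempty {v // (tileAt δ v).east = .rightGuard} := ⟨⟨v, h⟩⟩
  obtain ⟨⟨u, hu⟩, hmax⟩ := Finite.exists_max
    fun v : {v // (tileAt δ v).east = .rightGuard} => (p v).1
  have hu' : pinAt δ u = none := by
    rcases tileAt_cases u with ⟨i, -, -, hi⟩ | h'
    · rw [hi] at hu
      simp only [inputTile] at hu
      split at hu <;> simp at hu
    · exact h'.1
  obtain ⟨v, hv, he⟩ := exists_east hp hO hu' (by simp [hu, Colour.notHigh])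
  have := hmax ⟨v, east_of_west_eq_rightGuard (he.symm.trans hu)⟩
  simp [hv] at this

theorem tileAt_cases_of_openToNorthOnly (hp : IsPlacement δ p) (hO : OpenToNorthOnly δ)
    (v : Fin δ.size) :
    (∃ i : ℕ, i ≤ w.length ∧ pinAt δ v = some (i, 0) ∧
      tileAt δ v = inputTile ((M.init w).cell i) (decide (i = w.length))) ∨
    (pinAt δ v = none ∧ ∃ e, tileAt δ v = M.blankTile e) ∨
    (pinAt δ v = none ∧ ∃ m a b c, M.Valid m b c ∧ tileAt δ v = M.cellTile m a b c) := by
  rcases tileAt_cases v with h | ⟨h, h' | h' | ⟨c, h'⟩ | ⟨c, h'⟩⟩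
  · exact .inl h
  · exact .inr (.inl ⟨h, h'⟩)
  · exact .inr (.inr ⟨h, h'⟩)
  · exact absurd (by rw [h']; rfl) (not_westGuard hp hO v)
  · exact absurd (by rw [h']; rfl) (not_eastGuard hp hO v)

/-- A blank tile of the bottom row is to the right of the input. -/
theorem blankTile_spec (hp : IsPlacement δ p) (hO : OpenToNorthOnly δ) {v : Fin δ.size} {e : Bool}
    (hv : tileAt δ v = M.blankTile e) (hpin : pinAt δ v = none) :
    w.length < (p v).1 ∧ (p v).2 = 0 ∧ ∃ u q, pinAt δ u = some q := by
  induction hn : (p v).1 using Nat.strong_induction_on generalizing v e with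
  | _ n ih =>
    obtain ⟨u, hu, he⟩ := exists_west hp hO hpin (by simp [hv, blankTile])
    have he : (tileAt δ u).east = .blank := by rw [he, hv]; rfl
    have h1 : (p u).1 + 1 = n := by simp [← hn, hu]
    -- Only the last input tile and blank tiles have `blank` in the east, so the walk to the west
    -- ends at the pin `(|w|, 0)`.
    rcases tileAt_cases_of_openToNorthOnly hp hO u with
      ⟨i, hi, hpi, ht⟩ | ⟨hpu, e', ht⟩ | ⟨-, m, a, b, c, -, ht⟩
    · have hpu := hp.1 u _ hpi
      have : i = w.length := by
        by_contra hne
        simp [ht, inputTile, hne] at he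
      refine ⟨?_, by simp [hu, hpu], u, _, hpi⟩
      rw [hpu] at h1
      simp at h1
      omega
    · obtain ⟨h2, h3, h4⟩ := ih (p u).1 (by omega) ht hpu rfl
      exact ⟨by omega, by simp [hu, h3], h4⟩
    · rw [ht] at he
      cases c <;> simp [cellTile] at he

/-- The diagram shows the run at the vertex `v`. -/
def Shows (δ : (M.simulation col idx w).Diag) (p : Fin δ.size → ℕ × ℕ) (v : Fin δ.size) : Prop :=
  (∃ c r, M.run w (p v).2 = some c ∧
    (tileAt δ v).north = .cell (decide ((p v).1 = 0)) r (c.cell (p v).1) ∧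
    (r = true → c.head ≤ (p v).1 ∧ ∀ i, (p v).1 < i → c.tape i = M.blank)) ∨
  ∃ n c, (p v).2 = n + 1 ∧ M.run w n = some c ∧ M.step c = none ∧
    (tileAt δ v).north = .result (c.cell (p v).1)

/-- The south side repeats what the row below shows, including the border flags. The flag of the
last column brings along that head and non-blank symbols lie no further east. -/
theorem cellTile_south (hp : IsPlacement δ p) (hO : OpenToNorthOnly δ) {v : Fin δ.size}
    (ih : ∀ u, (p u).2 < (p v).2 → Shows δ p u) (hv : pinAt δ v = none) {m : Bool}
    {a : Option (Γ × Option Q)} {b : Γ × Option Q} {e : Option (Γ × Option Q)}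
    (ht : tileAt δ v = M.cellTile m a b e) :
    ∃ n c, (p v).2 = n + 1 ∧ M.run w n = some c ∧ a.isNone = decide ((p v).1 = 0) ∧
      b = c.cell (p v).1 ∧
      (e = none → c.head ≤ (p v).1 ∧ ∀ i, (p v).1 < i → c.tape i = M.blank) := by
  obtain ⟨u, hu, he⟩ := exists_south hp hO hv (by simp [ht, cellTile])
  have h1 : (p v).1 = (p u).1 := by simp [hu]
  have h2 : (p v).2 = (p u).2 + 1 := by simp [hu]
  rcases ih u (by omega) with ⟨c, r, hr, hn, hb⟩ | ⟨n, c, -, -, -, hn⟩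
  · rw [he, ht] at hn
    simp only [cellTile, Colour.cell.injEq] at hn
    obtain ⟨ha, hc, hb'⟩ := hn
    rw [h1]
    exact ⟨_, c, h2, hr, ha, hb', fun h => hb (by simp [← hc, h])⟩
  · rw [he, ht] at hn
    simp [cellTile] at hn

/-- A `row` colour occurs on cell tiles only and names the halting bit and both adjacent contents,
so the neighbour shares all three. -/
theorem cellTile_west (hp : IsPlacement δ p) (hO : OpenToNorthOnly δ) {v : Fin δ.size}
    (hv : pinAt δ v = none) {m : Bool} {a b : Γ × Option Q} {e : Option (Γ × Option Q)}
    (ht : tileAt δ v = M.cellTile m (some a) b e) :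
    ∃ u a', p v = p u + (1, 0) ∧ pinAt δ u = none ∧ M.Valid m a (some b) ∧
      tileAt δ u = M.cellTile m a' a (some b) := by
  obtain ⟨u, hu, he⟩ := exists_west hp hO hv (by simp [ht, cellTile])
  rw [ht] at he
  rcases tileAt_cases_of_openToNorthOnly hp hO u with
    ⟨i, -, -, hu'⟩ | ⟨-, e', hu'⟩ | ⟨hpu, m', a', b', c', hval, hu'⟩ <;> rw [hu'] at he
  · simp only [inputTile, cellTile] at he
    split at he <;> simp at he
  · simp only [blankTile, cellTile] at he
    split at he <;> simp at he
  · rcases c' with _ | c' <;> simp [cellTile] at he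
    obtain ⟨rfl, rfl, rfl⟩ := he
    exact ⟨u, a', hu, hpu, hval, hu'⟩

theorem cellTile_east (hp : IsPlacement δ p) (hO : OpenToNorthOnly δ) {v : Fin δ.size}
    (hv : pinAt δ v = none) {m : Bool} {a : Option (Γ × Option Q)} {b e : Γ × Option Q}
    (ht : tileAt δ v = M.cellTile m a b (some e)) :
    ∃ u e', p u = p v + (1, 0) ∧ pinAt δ u = none ∧ M.Valid m e e' ∧
      tileAt δ u = M.cellTile m (some b) e e' := by
  obtain ⟨u, hu, he⟩ := exists_east hp hO hv (by simp [ht, cellTile, Colour.notHigh])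
  rw [ht] at he
  rcases tileAt_cases_of_openToNorthOnly hp hO u with
    ⟨i, -, -, hu'⟩ | ⟨-, e', hu'⟩ | ⟨hpu, m', a', b', c', hval, hu'⟩ <;> rw [hu'] at he
  · simp only [inputTile, cellTile, Option.elim] at he
    split at he <;> simp at he
  · simp [blankTile, cellTile] at he
  · rcases a' with _ | a' <;> simp [cellTile] at he
    obtain ⟨rfl, rfl, rfl⟩ := he
    exact ⟨u, c', hu, hpu, hval, hu'⟩

/-- All tiles of a row know whether the machine halts. -/
theorem cellTile_mode (hp : IsPlacement δ p) (hO : OpenToNorthOnly δ) {n : ℕ} {c : Config Q Γ}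
    (hc : M.run w n = some c) (d : ℕ) {v : Fin δ.size} (hn : (p v).2 = n + 1)
    (ih : ∀ u, (p u).2 < n + 1 → Shows δ p u) (hv : pinAt δ v = none) {m : Bool}
    {a : Option (Γ × Option Q)} {b : Γ × Option Q} {e : Option (Γ × Option Q)}
    (hval : M.Valid m b e) (ht : tileAt δ v = M.cellTile m a b e)
    (hd : (p v).1 = c.head + d ∨ (p v).1 + d = c.head) : m = true ↔ M.step c = none := by
  -- Induction on the distance to the head: under the head `Valid` fixes the bit, elsewhere it is
  -- inherited from the neighbour nearer to the head.
  induction d generalizing v a b e with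
  | zero =>
    obtain ⟨n', c', hn', hc', -, rfl, -⟩ := cellTile_south hp hO (hn ▸ ih) hv ht
    obtain rfl : n' = n := by omega
    obtain rfl : c' = c := Option.some.inj (hc'.symm.trans hc)
    have : (p v).1 = c'.head := by omega
    rw [this, Config.cell_head] at hval
    rw [step_eq_none_iff]
    exact (hval _ rfl).1
  | succ d ihd =>
    obtain ⟨n', c', hn', hc', ha, rfl, he⟩ := cellTile_south hp hO (hn ▸ ih) hv ht
    obtain rfl : n' = n := by omega
    obtain rfl : c' = c := Option.some.inj (hc'.symm.trans hc)
    -- No border lies between the cell and the head: `a` is missing in column 0 only, and `e` only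
    -- where the head is not further east.
    rcases hd with hd | hd
    · rcases a with _ | a
      · simp at ha
        omega
      · obtain ⟨u, a', hu, hpu, hval', ht'⟩ := cellTile_west hp hO hv ht
        have h1 : (p v).1 = (p u).1 + 1 := by simp [hu]
        have h2 : (p v).2 = (p u).2 := by simp [hu]
        exact ihd (by omega) hpu hval' ht' (by omega)
    · rcases e with _ | e
      · have := (he rfl).1
        omega
      · obtain ⟨u, e', hu, hpu, hval', ht'⟩ := cellTile_east hp hO hv ht
        have h1 : (p u).1 = (p v).1 + 1 := by simp [hu]
        have h2 : (p u).2 = (p v).2 := by simp [hu]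
        exact ihd (by omega) hpu hval' ht' (by omega)

/-- A cell tile shows the contents of its cell and of the cells next to it. -/
theorem cellTile_spec (hp : IsPlacement δ p) (hO : OpenToNorthOnly δ) {v : Fin δ.size}
    (ih : ∀ u, (p u).2 < (p v).2 → Shows δ p u) (hv : pinAt δ v = none) {m : Bool}
    {a : Option (Γ × Option Q)} {b : Γ × Option Q} {e : Option (Γ × Option Q)}
    (hval : M.Valid m b e) (ht : tileAt δ v = M.cellTile m a b e) :
    ∃ n c, (p v).2 = n + 1 ∧ M.run w n = some c ∧ a = c.west (p v).1 ∧
      b = c.cell (p v).1 ∧ (m = true ↔ M.step c = none) ∧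
      (e = some (c.cell ((p v).1 + 1)) ∨
        e = none ∧ c.head ≤ (p v).1 ∧ ∀ i, (p v).1 < i → c.tape i = M.blank) := by
  obtain ⟨n, c, hn, hc, ha, hb, he⟩ := cellTile_south hp hO ih hv ht
  refine ⟨n, c, hn, hc, ?_, hb, ?_, ?_⟩
  · rcases a with _ | a
    · simp at ha
      simp [Config.west, ha]
    · obtain ⟨u, a', hu, hpu, hval', ht'⟩ := cellTile_west hp hO hv ht
      have h1 : (p v).1 = (p u).1 + 1 := by simp [hu]
      have h2 : (p v).2 = (p u).2 := by simp [hu]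
      obtain ⟨n', c', hn', hc', -, hb', -⟩ := cellTile_south hp hO (h2 ▸ ih) hpu ht'
      obtain rfl : n' = n := by omega
      obtain rfl : c' = c := Option.some.inj (hc'.symm.trans hc)
      simp [Config.west, h1, hb']
  · rcases le_total c.head (p v).1 with h | h
    · exact cellTile_mode hp hO hc ((p v).1 - c.head) hn (hn ▸ ih) hv hval ht (by omega)
    · exact cellTile_mode hp hO hc (c.head - (p v).1) hn (hn ▸ ih) hv hval ht (by omega)
  · rcases e with _ | e
    · exact .inr ⟨rfl, he rfl⟩
    · obtain ⟨u, e', hu, hpu, hval', ht'⟩ := cellTile_east hp hO hv ht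
      have h1 : (p u).1 = (p v).1 + 1 := by simp [hu]
      have h2 : (p v).2 = (p u).2 := by simp [hu]
      obtain ⟨n', c', hn', hc', -, hb', -⟩ := cellTile_south hp hO (h2 ▸ ih) hpu ht'
      obtain rfl : n' = n := by omega
      obtain rfl : c' = c := Option.some.inj (hc'.symm.trans hc)
      rw [h1] at hb'
      exact .inl (congrArg some hb')

/-- With `a`, `b`, `e` known to be true contents, the north side follows from `next_eq_cell`. What
remains is that head and non-blank symbols stay within the last column. -/
theorem shows_cellTile (hp : IsPlacement δ p) (hO : OpenToNorthOnly δ) {v : Fin δ.size}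
    (ih : ∀ u, (p u).2 < (p v).2 → Shows δ p u) (hv : pinAt δ v = none) {m : Bool}
    {a : Option (Γ × Option Q)} {b : Γ × Option Q} {e : Option (Γ × Option Q)}
    (hval : M.Valid m b e) (ht : tileAt δ v = M.cellTile m a b e) : Shows δ p v := by
  obtain ⟨n, c, hn, hc, ha, hb, hm, he⟩ := cellTile_spec hp hO ih hv hval ht
  rcases hs : M.step c with _ | c'
  · refine .inr ⟨n, c, hn, hc, hs, ?_⟩
    simp [ht, cellTile, hm.2 hs, hb]
  · have hm : m = false := by
      rcases m
      · rfl
      · simp [hs] at hm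
    refine .inl ⟨c', e.isNone, by rw [hn, run_succ hc, hs], ?_, fun h => ?_⟩
    · have h1 : M.next (c.west (p v).1) (c.cell (p v).1) e = c'.cell (p v).1 :=
        next_eq_cell hs (by tauto)
      have h2 : (c.west (p v).1).isNone = decide ((p v).1 = 0) := by
        unfold Config.west
        split <;> simp_all
      simp [ht, cellTile, hm, ha, hb, h1, h2]
    · rcases he with rfl | ⟨rfl, hh, hblank⟩
      · simp at h
      · obtain ⟨q, s, mv, htr, rfl⟩ := step_eq_some hs
        constructor
        · simp only
          -- A head in the last column does not move right, by `Valid`; a head before it moves at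
          -- most into it.
          rcases hh.eq_or_lt with heq | hlt
          · rw [← heq] at hb ⊢
            rw [hb, Config.cell_head] at hval
            rcases mv with _ | _ | _
            · simp [Move.apply]
            · exact absurd htr ((hval _ rfl).2 rfl q s)
            · simp [Move.apply]
          · cases mv <;> simp only [Move.apply] <;> omega
        · intro i hi
          simp only
          rw [Function.update_of_ne (by omega)]
          exact hblank i hi

/-- Only cell 0 carries a state at the start; this is how an input tile recognises the western
border from its content alone. -/
theorem init_cell_isSome (M : Machine Q Γ) (w : List Γ) (i : ℕ) :
    ((M.init w).cell i).2.isSome = decide (i = 0) := by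
  simp only [Config.cell, init]
  rcases i with _ | i <;> simp

theorem init_cell_of_lt {i : ℕ} (h : w.length ≤ i) (hi : 0 < i) :
    (M.init w).cell i = (M.blank, none) := by
  rw [Config.cell_of_ne (by simpa [init] using hi.ne)]
  simp [init, h]

/-- Induction on the row, with pinned and blank tiles as the base. Flatness is not needed: several
vertices may lie in one cell, and each shows the run. -/
theorem shows (hp : IsPlacement δ p) (hO : OpenToNorthOnly δ) (v : Fin δ.size) : Shows δ p v := by
  induction hn : (p v).2 using Nat.strong_induction_on generalizing v with
  | _ n ih =>
    rcases tileAt_cases_of_openToNorthOnly hp hO v with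
      ⟨i, hi, hpi, ht⟩ | ⟨hv, e, ht⟩ | ⟨hv, m, a, b, c, hval, ht⟩
    · have hpv := hp.1 v _ hpi
      refine .inl ⟨M.init w, false, by rw [hpv]; rfl, ?_, by simp⟩
      rw [ht, hpv]
      simp [inputTile, init_cell_isSome]
    · obtain ⟨h1, h2, -⟩ := blankTile_spec hp hO ht hv
      refine .inl ⟨M.init w, e, by rw [h2]; rfl, ?_, fun _ => ⟨Nat.zero_le _, fun i hi => ?_⟩⟩
      · rw [ht, init_cell_of_lt h1.le (by omega)]
        simp [blankTile]
        omega
      · simp only [init]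
        rw [List.getD_eq_default _ _ (by omega)]
    · exact shows_cellTile hp hO (fun u hu => ih _ (hn ▸ hu) u rfl) hv hval ht

/-- A lowest tile is no cell tile, since that would need a tile below it; it is pinned, or blank and
thus connected to a pin. The pin makes all coordinates ground. -/
theorem exists_pinned (hp : IsPlacement δ p) (hO : OpenToNorthOnly δ) :
    ∃ u q, pinAt δ u = some q := by
  have := δ.nonempty_vertices
  obtain ⟨v, hmin⟩ := Finite.exists_min fun v => (p v).2
  rcases tileAt_cases_of_openToNorthOnly hp hO v with
    ⟨i, hi, hpi, ht⟩ | ⟨hv, e, ht⟩ | ⟨hv, m, a, b, c, hval, ht⟩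
  · exact ⟨v, _, hpi⟩
  · exact (blankTile_spec hp hO ht hv).2.2
  · obtain ⟨u, hu, -⟩ := exists_south hp hO hv (by simp [ht, cellTile])
    have := hmin u
    simp [hu] at this

/-- A tile above the bottom row is a cell tile. -/
theorem exists_cellTile (hp : IsPlacement δ p) (hO : OpenToNorthOnly δ) {v : Fin δ.size}
    {n : ℕ} (hn : (p v).2 = n + 1) :
    pinAt δ v = none ∧ ∃ m a b c, M.Valid m b c ∧ tileAt δ v = M.cellTile m a b c := by
  rcases tileAt_cases_of_openToNorthOnly hp hO v with ⟨i, hi, hpi, ht⟩ | ⟨hv, e, ht⟩ | h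
  · rw [hp.1 v _ hpi] at hn
    simp at hn
  · have := (blankTile_spec hp hO ht hv).2.1
    omega
  · exact h

/-- A closed diagram shows the final configuration. -/
theorem exists_result_row (hp : IsPlacement δ p) (hC : δ.Closed) :
    ∃ v n c, (p v).2 = n + 1 ∧ M.run w n = some c ∧ M.step c = none := by
  have hO := openToNorthOnly_of_closed hC
  have := δ.nonempty_vertices
  obtain ⟨v, hmax⟩ := Finite.exists_max fun v => (p v).2
  -- In the topmost row a `cell` colour is impossible: it fits an eastern guard, so closedness would
  -- force a tile above.
  rcases shows hp hO v with ⟨c, r, -, h, -⟩ | ⟨n, c, hn, hc, hs, -⟩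
  · obtain ⟨u, hu, -⟩ := exists_north hp hC (v := v) (by simp [h, Colour.notHigh])
    have := hmax u
    simp [hu] at this
  · exact ⟨v, n, c, hn, hc, hs⟩

end RightTM.Machine

/-! ### Space-time diagrams of runs -/

namespace RightTM.Machine

open Wang Stellar

variable {Q Γ : Type}

/-- The tiling by the first rows of the run on the columns `0, …, last`. -/
noncomputable def runTiling (M : Machine Q Γ) {k : ℕ} (idx : Fin k ≃ TileName (Γ × Option Q))
    (w : List Γ) (last : ℕ) : ℕ × ℕ → Fin k ⊕ Fin (w.length + 1)
  | (i, 0) => if h : i < w.length + 1 then .inr ⟨i, h⟩ else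
      .inl (idx.symm (.inl (.inl (decide (i = last)))))
  | (i, n + 1) =>
      -- The default is never seen: row `n + 1` is used only if the run has a configuration after
      -- `n` steps.
      let c := (M.run w n).getD (M.init w)
      .inl (idx.symm (.inl (.inr ((M.step c).isNone, c.west i, c.cell i,
        if i = last then none else some (c.cell (i + 1))))))

variable {M : Machine Q Γ} {C : Type} {k : ℕ}
  {col : Colour (Γ × Option Q) ≃ C} {idx : Fin k ≃ TileName (Γ × Option Q)} {w : List Γ}
  {last : ℕ}

theorem isNone_ite {α : Type} (q : Prop) [Decidable q] (x : α) :
    (if q then none else some x).isNone = decide q := by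
  split <;> simp_all

theorem colourTile_runTiling_zero (i : ℕ) :
    M.colourTile idx w (runTiling M idx w last (i, 0)) =
      if i ≤ w.length then inputTile ((M.init w).cell i) (decide (i = w.length))
      else M.blankTile (decide (i = last)) := by
  by_cases h : i < w.length + 1
  · simp [runTiling, h, colourTile, Nat.le_of_lt_succ h]
  · simp [runTiling, h, colourTile, program, show ¬ i ≤ w.length by omega]

theorem colourTile_runTiling_succ {n : ℕ} {c : Config Q Γ} (hc : M.run w n = some c)
    (hn : n < last) (i : ℕ) : M.colourTile idx w (runTiling M idx w last (i, n + 1)) =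
      M.cellTile (M.step c).isNone (c.west i) (c.cell i)
        (if i = last then none else some (c.cell (i + 1))) := by
  have hval : M.Valid (M.step c).isNone (c.cell i)
      (if i = last then none else some (c.cell (i + 1))) := by
    intro q hq
    have hi : c.head = i := by
      by_contra h
      simp [Config.cell_of_ne h] at hq
    subst hi
    -- From `head ≤ n < last` the head is not in the last column, which voids the second condition
    -- of `Valid`.
    have := head_le hc
    rw [if_neg (by omega)]
    rw [Config.cell_head, Option.some.injEq] at hq
    subst hq
    rw [Config.cell_head, Option.isNone_iff_eq_none, step_eq_none_iff]
    simp
  simp [runTiling, hc, colourTile, program, hval]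

theorem runTiling_row {n : ℕ} (hw : w.length < last) (hn : ∀ m < n, (M.run w m).isSome)
    (hl : n ≤ last) (i : ℕ) :
    (i = 0 → (M.colourTile idx w (runTiling M idx w last (i, n))).west = .low) ∧
    (i = last → (M.colourTile idx w (runTiling M idx w last (i, n))).east = .high) ∧
    (i < last → (M.colourTile idx w (runTiling M idx w last (i, n))).east =
      (M.colourTile idx w (runTiling M idx w last (i + 1, n))).west) := by
  rcases n with _ | n
  · simp only [colourTile_runTiling_zero]
    refine ⟨?_, ?_, ?_⟩
    · rintro rfl
      simp [inputTile, init_cell_isSome]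
    · rintro rfl
      simp [Nat.not_le.2 hw, blankTile]
    · intro hi
      rcases lt_trichotomy i w.length with h | h | h
      · rw [if_pos h.le, if_pos (by omega)]
        simp [inputTile, init_cell_isSome, h.ne]
      · rw [if_pos h.le, if_neg (by omega)]
        simp [inputTile, blankTile, h]
      · rw [if_neg (by omega), if_neg (by omega)]
        simp [blankTile, hi.ne]
  · obtain ⟨c, hc⟩ := Option.isSome_iff_exists.1 (hn n (by omega))
    simp only [colourTile_runTiling_succ hc (show n < last by omega)]
    refine ⟨?_, ?_, ?_⟩
    · rintro rfl
      simp [cellTile, Config.west]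
    · rintro rfl
      simp [cellTile]
    · intro hi
      simp [cellTile, Config.west, hi.ne]

theorem runTiling_south_zero (i : ℕ) :
    (M.colourTile idx w (runTiling M idx w last (i, 0))).south = .low := by
  rw [colourTile_runTiling_zero]
  split <;> rfl

theorem runTiling_south_succ {n : ℕ} {c : Config Q Γ} (hc : M.run w n = some c)
    (hl : n < last) (i : ℕ) : (M.colourTile idx w (runTiling M idx w last (i, n + 1))).south =
      .cell (decide (i = 0)) (decide (i = last)) (c.cell i) := by
  rw [colourTile_runTiling_succ hc hl]
  simp [cellTile, Config.west, isNone_ite]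

theorem runTiling_north {n : ℕ} {c : Config Q Γ} (hc : M.run w n = some c) (hw : w.length < last)
    (hl : n ≤ last) (i : ℕ) :
    (M.colourTile idx w (runTiling M idx w last (i, n))).north =
      .cell (decide (i = 0)) (decide (i = last)) (c.cell i) := by
  rcases n with _ | n
  · obtain rfl : M.init w = c := Option.some.inj hc
    rw [colourTile_runTiling_zero]
    split
    · have : i ≠ last := by omega
      simp [inputTile, init_cell_isSome, this]
    · rw [init_cell_of_lt (by omega) (by omega)]
      have : i ≠ 0 := by omega
      simp [blankTile, this]
  · obtain ⟨d, hd⟩ := Option.isSome_iff_exists.1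
      (run_isSome_of_le (M := M) (w := w) (Nat.le_succ n) (by rw [hc]; rfl))
    have hs : M.step d = some c := (run_succ hd).symm.trans hc
    rw [colourTile_runTiling_succ hd (by omega)]
    have := head_le hd
    rw [cellTile, hs, next_eq_cell hs]
    · simp [Config.west, isNone_ite]
    · by_cases h1 : i = last
      · exact .inr ⟨by simp [h1], by omega⟩
      · exact .inl (by simp [h1])

theorem runTiling_north_of_halt {n : ℕ} {c : Config Q Γ} (hc : M.run w n = some c)
    (hs : M.step c = none) (hl : n < last) (i : ℕ) :
    (M.colourTile idx w (runTiling M idx w last (i, n + 1))).north = .result (c.cell i) := by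
  rw [colourTile_runTiling_succ hc hl]
  simp [cellTile, hs]

/-- The rectangle `{0, …, m} × {0, …, n}`. -/
def rectangle (m n : ℕ) : Finset (ℕ × ℕ) := Finset.range (m + 1) ×ˢ Finset.range (n + 1)

theorem mem_rectangle {m n : ℕ} {d : ℕ × ℕ} : d ∈ rectangle m n ↔ d.1 ≤ m ∧ d.2 ≤ n := by
  simp [rectangle]

/-- Every cell is reached along the bottom row and then up its column. -/
theorem connectedRegion_rectangle (m n : ℕ) : ConnectedRegion (rectangle m n) := by
  have h0 : ((0, 0) : ℕ × ℕ) ∈ (rectangle m n : Set (ℕ × ℕ)) := by simp [mem_rectangle]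
  have key : ∀ j i, ∀ h : (i, j) ∈ (rectangle m n : Set (ℕ × ℕ)),
      ((SimpleGraph.hasse ℕ □ SimpleGraph.hasse ℕ).induce
        (rectangle m n : Set (ℕ × ℕ))).Reachable ⟨(0, 0), h0⟩ ⟨(i, j), h⟩ := by
    intro j
    induction j with
    | zero =>
      intro i
      induction i with
      | zero => exact fun h => SimpleGraph.Reachable.refl _
      | succ i ih =>
        intro h
        have h' : (i, 0) ∈ (rectangle m n : Set (ℕ × ℕ)) := by
          simp [mem_rectangle] at h ⊢; omega
        exact (ih h').trans (SimpleGraph.Adj.reachable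
          (Touch.grid_adj (i := E) (j := W) (.inl ⟨rfl, rfl, rfl⟩)))
    | succ j ih =>
      intro i h
      have h' : (i, j) ∈ (rectangle m n : Set (ℕ × ℕ)) := by
        simp [mem_rectangle] at h ⊢; omega
      exact (ih i h').trans (SimpleGraph.Adj.reachable
        (Touch.grid_adj (i := N) (j := S) (.inr (.inr (.inl ⟨rfl, rfl, rfl⟩)))))
  exact { preconnected := fun u v => (key _ _ u.2).symm.trans (key _ _ v.2)
          nonempty := ⟨⟨(0, 0), h0⟩⟩ }

/-- Row `n` needs only the configuration after `n - 1` steps; asking for `m < n` admits the result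
row on top of a halting configuration. -/
theorem isTiling_runTiling {n : ℕ} (hw : w.length < last) (hn : ∀ m < n, (M.run w m).isSome)
    (hl : n ≤ last) :
    IsTiling (M.simulation col idx w) (rectangle last n) (runTiling M idx w last) := by
  refine ⟨?_, ?_, ?_⟩
  · rintro ⟨i, j⟩ - q hq
    rcases j with _ | j
    · by_cases h : i < w.length + 1
      · simp only [runTiling, h, dif_pos] at hq
        rw [simulation_pin_inr] at hq
        exact Option.some.inj hq
      · simp only [runTiling, h, dif_neg, not_false_eq_true] at hq
        rw [simulation_pin_inl] at hq
        cases hq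
    · simp only [runTiling] at hq
      rw [simulation_pin_inl] at hq
      cases hq
  · rintro ⟨i, j⟩ hd hd'
    simp only [mem_rectangle, Prod.fst_add, Prod.snd_add] at hd hd'
    rw [simulation_tile, simulation_tile]
    exact congrArg col ((runTiling_row hw (fun m hm => hn m (by omega)) (by omega) i).2.2
      (by omega))
  · rintro ⟨i, j⟩ hd hd'
    simp only [mem_rectangle, Prod.fst_add, Prod.snd_add] at hd hd'
    rw [simulation_tile, simulation_tile]
    refine congrArg col ?_
    obtain ⟨c, hc⟩ := Option.isSome_iff_exists.1 (hn j (by omega))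
    exact (runTiling_north hc hw (by omega) i).trans
      (runTiling_south_succ hc (by omega) i).symm

variable [Countable C]

/-- In a diagram of `runTiling`, only northern sides of the top row can still be connected. -/
theorem runTiling_free {n : ℕ} (hw : w.length < last) (hn : ∀ m < n, (M.run w m).isSome)
    (hl : n ≤ last) {δ : (M.simulation col idx w).Diag} {p : Fin δ.size → ℕ × ℕ}
    (hp : IsFlat δ p) (hr : Set.range p = rectangle last n)
    (hτ : ∀ v, δ.star v = runTiling M idx w last (p v)) {v : Fin δ.size} {a : ℕ}
    (ha : (v, a) ∈ δ.free) {r : Ray (sig C)} (hray : δ.HasRay (v, a) r)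
    {i : (M.simulation col idx w).index} {s : Ray (sig C)}
    (hs : s ∈ ((M.simulation col idx w).constellation.star i).1) (hd : Dual Set.univ r s) :
    a = N ∧ (p v).2 = n ∧
      (M.colourTile idx w (runTiling M idx w last (p v))).north = (M.colourTile idx w i).south := by
  obtain ⟨b, hb⟩ := List.mem_iff_getElem?.1 hs
  have hf := Dual.fits (hasRay_iff.1 hray) ((star_getElem i b).symm.trans hb) hd
  have htile : (M.simulation col idx w).tile (δ.star v) =
      mapTile col (M.colourTile idx w (runTiling M idx w last (p v))) :=
    (simulation_tile col idx w (δ.star v)).trans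
      (congrArg (fun x => mapTile col (M.colourTile idx w x)) (hτ v))
  rw [htile, show (M.simulation col idx w).tile i = _ from simulation_tile col idx w i] at hf
  have hmem : ∀ d, d.1 ≤ last → d.2 ≤ n → ∃ u, p u = d := fun d h1 h2 => by
    have : d ∈ Set.range p := by
      rw [hr]; exact mem_rectangle.2 ⟨h1, h2⟩
    exact this
  have hv : (p v).1 ≤ last ∧ (p v).2 ≤ n := by
    have : p v ∈ Set.range p := ⟨v, rfl⟩
    rw [hr] at this
    exact mem_rectangle.1 this
  rcases hpv : p v with ⟨x, y⟩
  rw [hpv] at hf hv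
  simp only at hv
  have hrow := runTiling_row (idx := idx) hw (fun m hm => hn m (lt_of_lt_of_le hm hv.2))
    (hv.2.trans hl) x
  -- Inner sides are linked by flatness and hence not free; sides on the western, eastern and
  -- southern borders have colours that no opposite side has.
  rcases hf with ⟨rfl, -, he⟩ | ⟨rfl, -, he⟩ | ⟨rfl, -, he⟩ | ⟨rfl, -, he⟩
  · have he := col.injective he
    rcases hv.1.eq_or_lt with h | h
    · rw [hrow.2.1 h] at he
      exact absurd he.symm (west_ne_high i)
    · obtain ⟨u, hu⟩ := hmem (x + 1, y) h hv.2
      exact absurd (hp.2.2.1 v u (by rw [hu, hpv]; rfl)) (ha.2 _)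
  · have he := col.injective he
    rcases x with _ | x
    · rw [hrow.1 rfl] at he
      exact absurd he (east_ne_low i)
    · obtain ⟨u, hu⟩ := hmem (x, y) (by omega) hv.2
      exact absurd (δ.link_symm _ _ (hp.2.2.1 u v (by rw [hu, hpv]; rfl))) (ha.2 _)
  · refine ⟨rfl, ?_, col.injective he⟩
    by_contra h
    obtain ⟨u, hu⟩ := hmem (x, y + 1) hv.1 (show y + 1 ≤ n by simp only at h; omega)
    exact absurd (hp.2.2.2 v u (by rw [hu, hpv]; rfl)) (ha.2 _)
  · have he := col.injective he
    rcases y with _ | y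
    · rw [runTiling_south_zero] at he
      exact absurd he (north_ne_low i)
    · obtain ⟨u, hu⟩ := hmem (x, y) hv.1 (show y ≤ n by omega)
      exact absurd (δ.link_symm _ _ (hp.2.2.2 u v (by rw [hu, hpv]; rfl))) (ha.2 _)

/-- Every finite part of the run has a space-time diagram. -/
theorem exists_run_diagram (col : Colour (Γ × Option Q) ≃ C)
    (idx : Fin k ≃ TileName (Γ × Option Q)) {n : ℕ} (hn : (M.run w n).isSome)
    (hl : w.length + n < last) :
    ∃ (δ : (M.simulation col idx w).Diag) (p : Fin δ.size → ℕ × ℕ),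
      δ.Correct ∧ IsFlat δ p ∧ OpenToNorthOnly δ ∧ Set.range p = {d | d.1 ≤ last ∧ d.2 ≤ n} ∧
      ∀ v, ∃ c l r, M.run w (p v).2 = some c ∧
        (M.simulation col idx w).tile (δ.star v) = mapTile col (tileAt δ v) ∧
        (tileAt δ v).north = .cell l r (c.cell (p v).1) := by
  have hn' : ∀ m < n, (M.run w m).isSome := fun m hm => run_isSome_of_le hm.le hn
  obtain ⟨δ, p, hc, hp, hr, hτ, -⟩ := exists_flat_diagram (T := M.simulation col idx w)
    (connectedRegion_rectangle last n) (isTiling_runTiling (by omega) hn' (by omega))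
  have hr' : Set.range p = {d | d.1 ≤ last ∧ d.2 ≤ n} := by
    rw [hr]; ext d; exact mem_rectangle
  refine ⟨δ, p, hc, hp, ?_, hr', fun v => ?_⟩
  · rintro ⟨v, a⟩ ha r hray ⟨i, s, hs, hd⟩
    exact (runTiling_free (by omega) hn' (by omega) hp hr hτ ha hray hs hd).1
  · have hv : p v ∈ {d : ℕ × ℕ | d.1 ≤ last ∧ d.2 ≤ n} := hr' ▸ ⟨v, rfl⟩
    obtain ⟨c, hc⟩ := Option.isSome_iff_exists.1 (run_isSome_of_le hv.2 hn)
    have h2 := hv.2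
    have hnorth := runTiling_north (idx := idx) (n := (p v).2) (last := last) hc (by omega)
      (by omega) (p v).1
    refine ⟨c, _, _, hc, tile_star v, Eq.trans ?_ hnorth⟩
    exact congrArg (fun x => (M.colourTile idx w x).north) (hτ v)

/-- A halting run has a closed diagram. -/
theorem exists_closed_diagram (col : Colour (Γ × Option Q) ≃ C)
    (idx : Fin k ≃ TileName (Γ × Option Q)) {n : ℕ} {c : Config Q Γ} (hc : M.run w n = some c)
    (hs : M.step c = none) :
    ∃ (δ : (M.simulation col idx w).Diag) (p : Fin δ.size → ℕ × ℕ),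
      IsPlacement δ p ∧ δ.Closed := by
  have hn : ∀ m < n + 1, (M.run w m).isSome := fun m hm =>
    run_isSome_of_le (Nat.le_of_lt_succ hm) (by rw [hc]; rfl)
  -- The last column lies beyond the input and the reach of the head; the extra row `n + 1` holds
  -- the `result` colours, which close the diagram.
  obtain ⟨δ, p, -, hp, hr, hτ, -⟩ := exists_flat_diagram (T := M.simulation col idx w)
    (connectedRegion_rectangle (w.length + n + 1) (n + 1))
    (isTiling_runTiling (by omega) hn (by omega))
  refine ⟨δ, p, hp.1, ?_⟩
  rintro ⟨v, a⟩ ha r hray i s hs' hd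
  obtain ⟨-, h1, h2⟩ := runTiling_free (by omega) hn (by omega) hp hr hτ ha hray hs' hd
  rcases hpv : p v with ⟨x, y⟩
  rw [hpv] at h1 h2
  simp only at h1
  subst h1
  rw [runTiling_north_of_halt hc hs (by omega)] at h2
  exact south_ne_result i _ h2.symm

end RightTM.Machine

/-! ### Minimal solutions and actualisations of diagrams with a pin -/

namespace Wang

open Stellar

variable {C : Type} [Countable C] {T : TileSet C} {δ : T.Diag} {p : Fin δ.size → ℕ × ℕ}

/-- A pin forces every solution to have the numerals of the placement as coordinates. A solution
that is the identity on all other variables is then minimal: each solution factors through it by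
itself. -/
theorem exists_isMinimalSolution (hp : IsPlacement δ p) {u : Fin δ.size} {q : ℕ × ℕ}
    (hu : T.pin (δ.star u) = some q) : ∃ ψ, IsMinimalSolution δ.problem ψ := by
  classical
  -- The coordinate variables of unpinned vertices, whose values are forced.
  let det : ℕ → Prop := fun x => ∃ v : Fin δ.size, T.pin (δ.star v) = none ∧
    (x = Nat.pair v 0 ∨ x = Nat.pair v 1)
  let ψ : ℕ → (sig C).Term := fun x => if det x then placeSubst p x else var x
  refine ⟨ψ, problem_solution hp fun v => ?_, fun θ hθ => ⟨θ, fun x => ?_⟩⟩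
  · rcases hq : T.pin (δ.star v) with _ | q'
    · have h0 : det (Nat.pair v 0) := ⟨v, hq, .inl rfl⟩
      have h1 : det (Nat.pair v 1) := ⟨v, hq, .inr rfl⟩
      simp only [coordAt, TileSet.coords, hq, subst_var, Diagram.rename]
      show (ψ (Nat.pair v 0), ψ (Nat.pair v 1)) = _
      simp [ψ, h0, h1, placeSubst]
    · rw [coordAt_of_pin hq, hp.1 v q' hq]
  · by_cases hx : det x
    · obtain ⟨v, hv, h⟩ := id hx
      have := coordAt_of_solution hθ hp hu v
      simp only [coordAt, TileSet.coords, hv, subst_var, Diagram.rename] at this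
      obtain ⟨h0, h1⟩ := Prod.ext_iff.1 this
      simp only [ψ, hx, if_true]
      rcases h with rfl | rfl
      · simpa [placeSubst] using h0
      · simpa [placeSubst] using h1
    · simp [ψ, hx]

theorem finite_free (δ : T.Diag) : Finite δ.free := by
  refine Set.Finite.subset ((Set.finite_univ (α := Fin δ.size)).prod (Set.finite_Iio 4)) ?_
  rintro ⟨v, i⟩ ⟨⟨r, hr⟩, -⟩
  refine ⟨trivial, ?_⟩
  rcases sideRay_eq_some (hasRay_iff.1 hr) with ⟨h, -⟩ | ⟨h, -⟩ | ⟨h, -⟩ | ⟨h, -⟩ <;>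
  simp only at h <;> simp [h, W, S, E, N]

theorem exists_isActualisation (hp : IsPlacement δ p) {u : Fin δ.size} {q : ℕ × ℕ}
    (hu : T.pin (δ.star u) = some q) : ∃ σ, δ.IsActualisation σ := by
  obtain ⟨ψ, hψ⟩ := exists_isMinimalSolution hp hu
  have := finite_free δ
  choose r hr using fun a : δ.free => a.2.1
  let e : Fin (Nat.card δ.free) ≃ δ.free := (Finite.equivFin δ.free).symm
  let l := List.ofFn fun k => ((r (e k)).subst (Diagram.rename (e k).1.1)).subst ψ
  have hl : l ≠ [] := by
    intro h
    have hlen := congrArg List.length h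
    simp only [l, List.length_ofFn, List.length_nil] at hlen
    have : Nonempty δ.free := hp.free_east.to_subtype
    exact Nat.card_pos.ne' hlen
  refine ⟨⟨l, hl⟩, ψ, hψ, (finCongr (List.length_ofFn ..)).trans e, fun k s hs => ?_⟩
  have hs' := hr (e (finCongr (List.length_ofFn ..) k))
  obtain rfl := Option.some.inj (hs'.symm.trans hs)
  exact List.get_ofFn _ k

end Wang

/-! ### Reading the final configuration off the execution -/

namespace RightTM.Machine

open Wang Stellar

variable {Q Γ : Type} {M : Machine Q Γ} {C : Type} [Countable C] {k : ℕ}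
  {col : Colour (Γ × Option Q) ≃ C} {idx : Fin k ≃ TileName (Γ × Option Q)} {w : List Γ}

/-- The content shown by a renamed side colour. -/
def decode (M : Machine Q Γ) (col : Colour (Γ × Option Q) ≃ C) (a : C) : Γ × Option Q :=
  (col.symm a).content (M.blank, none)

theorem decode_north {δ : (M.simulation col idx w).Diag} (v : Fin δ.size) :
    M.decode col ((M.simulation col idx w).tile (δ.star v)).north =
      (tileAt δ v).north.content (M.blank, none) := by
  rw [tile_star]
  simp [decode, mapTile]

variable {δ : (M.simulation col idx w).Diag} {p : Fin δ.size → ℕ × ℕ}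

/-- The tiles of the row above a halting configuration. -/
theorem top_row (hp : IsPlacement δ p) (hO : OpenToNorthOnly δ) {n : ℕ} {c : Config Q Γ}
    (hc : M.run w n = some c) (hs : M.step c = none) {v : Fin δ.size} (hn : (p v).2 = n + 1) :
    pinAt δ v = none ∧ (tileAt δ v).north = .result (c.cell (p v).1) ∧
      ∃ e, tileAt δ v = M.cellTile true (c.west (p v).1) (c.cell (p v).1) e ∧
        (e = some (c.cell ((p v).1 + 1)) ∨
          e = none ∧ c.head ≤ (p v).1 ∧ ∀ i, (p v).1 < i → c.tape i = M.blank) := by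
  obtain ⟨hv, m, a, b, e, hval, ht⟩ := exists_cellTile hp hO hn
  obtain ⟨n', c', hn', hc', rfl, rfl, hm, he⟩ :=
    cellTile_spec hp hO (fun u _ => shows hp hO u) hv hval ht
  obtain rfl : n' = n := by omega
  obtain rfl : c' = c := Option.some.inj (hc'.symm.trans hc)
  obtain rfl := hm.2 hs
  exact ⟨hv, by rw [ht]; rfl, e, ht, he⟩

/-- The top row of a closed diagram carries the final configuration. -/
theorem exists_top_row (hp : IsPlacement δ p) (hC : δ.Closed) {n : ℕ} {c : Config Q Γ}
    (hc : M.run w n = some c) (hs : M.step c = none) :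
    ∃ last : ℕ, c.head ≤ last ∧ (∀ i, last < i → c.tape i = M.blank) ∧
      (∀ i ≤ last, ∃ v, p v = (i, n + 1)) ∧ ∀ v, (p v).2 = n + 1 → (p v).1 ≤ last := by
  have hO := openToNorthOnly_of_closed hC
  obtain ⟨v₀, n', c', hn', hc', hs'⟩ := exists_result_row hp hC
  obtain ⟨rfl, rfl⟩ := halting_unique hc' hc hs' hs
  have : Nonempty {v // (p v).2 = n' + 1} := ⟨⟨v₀, hn'⟩⟩
  -- At an easternmost tile of the row the eastern content must be missing, since otherwise a
  -- further tile would follow.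
  obtain ⟨⟨v, hv⟩, hmax⟩ := Finite.exists_max fun v : {v // (p v).2 = n' + 1} => (p v).1
  obtain ⟨hpin, -, e, ht, he⟩ := top_row hp hO hc hs hv
  have he : c'.head ≤ (p v).1 ∧ ∀ i, (p v).1 < i → c'.tape i = M.blank := by
    rcases he with rfl | he
    · obtain ⟨u, -, hu, -⟩ := cellTile_east hp hO hpin ht
      have := hmax ⟨u, by simp [hu, hv]⟩
      simp [hu] at this
    · exact he.2
  refine ⟨(p v).1, he.1, he.2, fun i hi => ?_, fun u hu => hmax ⟨u, hu⟩⟩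
  -- Induction on the distance `d` from the easternmost tile: each tile outside column 0 has a
  -- western neighbour in the row.
  obtain ⟨d, hd⟩ := Nat.exists_eq_add_of_le hi
  induction d generalizing i with
  | zero => exact ⟨v, Prod.ext hd hv⟩
  | succ d ih =>
    obtain ⟨u, hu⟩ := ih (i + 1) (by omega) (by omega)
    obtain ⟨hpin, -, e, ht, -⟩ := top_row hp hO hc hs (v := u) (by rw [hu])
    rw [Config.west, if_neg (by simp [hu])] at ht
    obtain ⟨u', -, hu', -⟩ := cellTile_west hp hO hpin ht
    rw [hu] at hu'
    refine ⟨u', ?_⟩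
    simp only [Prod.ext_iff, Prod.fst_add, Prod.snd_add] at hu' ⊢
    omega

/-- `result` is the colour of no south side, so nothing can be joined here. -/
theorem north_free {v : Fin δ.size}
    {b : Γ × Option Q} (h : (tileAt δ v).north = .result b) : (v, N) ∈ δ.free := by
  refine ⟨⟨_, hasRay_iff.2 (sideRay_N ..)⟩, fun ⟨u, j⟩ hl => ?_⟩
  have := link_fits hl
  rw [tile_star, tile_star] at this
  simp only [Fits, E, W, N, S, mapTile] at this
  simp at this
  exact south_ne_result (M := M) (idx := idx) (δ.star u) b (this.2.symm.trans h)

/-- The pin makes the coordinates numerals. A northern ray carries s(y), so the result row `n + 1`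
yields the numeral `n + 2`. -/
theorem vRay_subst (hp : IsPlacement δ p) {ψ : ℕ → (sig C).Term} (hψ : IsSolution δ.problem ψ)
    {u : Fin δ.size} {q : ℕ × ℕ} (hu : pinAt δ u = some q) (v : Fin δ.size) (a : C) :
    ((vRay .pos a ((M.simulation col idx w).coords (δ.star v)).1
      (succ ((M.simulation col idx w).coords (δ.star v)).2)).subst (Diagram.rename v)).subst ψ =
      vRay .pos a (num (p v).1) (num ((p v).2 + 1)) := by
  obtain ⟨h1, h2⟩ := Prod.ext_iff.1 (coordAt_of_solution hψ hp hu v)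
  simp only [coordAt] at h1 h2
  rw [subst_vRay, subst_vRay, subst_succ, subst_succ, h1, h2]
  rfl

/-- The final configuration is read off from the result of the execution. -/
theorem exec_spec {n : ℕ} {c : Config Q Γ} (hc : M.run w n = some c) (hs : M.step c = none)
    {σ : Star (sig C)} (hσ : σ ∈ exec Set.univ (M.simulation col idx w).constellation) :
    ∃ last : ℕ, c.head ≤ last ∧ (∀ i, last < i → c.tape i = M.blank) ∧
      (∀ i ≤ last, ∃ a, M.decode col a = c.cell i ∧ vRay .pos a (num i) (num (n + 2)) ∈ σ.1) ∧
      (∀ ts, Ray.polarised .pos vColour ts ∈ σ.1 → ∃ i ≤ last, ∃ a, M.decode col a = c.cell i ∧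
        Ray.polarised .pos vColour ts = vRay .pos a (num i) (num (n + 2))) := by
  obtain ⟨δ, hcor, hsat, ψ, ⟨hψ, -⟩, e, he⟩ := hσ
  obtain ⟨p, hp⟩ := correct_iff.1 hcor
  have hC := hsat.closed
  have hO := openToNorthOnly_of_closed hC
  obtain ⟨u, q, hu⟩ := exists_pinned hp hO
  obtain ⟨last, h1, h2, h3, h4⟩ := exists_top_row hp hC hc hs
  refine ⟨last, h1, h2, fun i hi => ?_, fun ts hts => ?_⟩
  · obtain ⟨v, hv⟩ := h3 i hi
    obtain ⟨-, hnorth, -⟩ := top_row hp hO hc hs (v := v) (by rw [hv])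
    have hfree := north_free hnorth
    have hget := he (e.symm ⟨_, hfree⟩) _
      (by rw [Equiv.apply_symm_apply]; exact hasRay_iff.2 (sideRay_N ..))
    rw [Equiv.apply_symm_apply] at hget
    refine ⟨((M.simulation col idx w).tile (δ.star v)).north, ?_, List.mem_iff_get.2
      ⟨_, hget.trans ((vRay_subst hp hψ hu v _).trans ?_)⟩⟩
    · rw [decode_north, hnorth, hv]; rfl
    · rw [hv]
  · obtain ⟨j, hj⟩ := List.mem_iff_get.1 hts
    rcases hej : e j with ⟨⟨v, i⟩, hfree⟩
    obtain ⟨r, hr⟩ := hfree.1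
    have hget := he j r (by rw [hej]; exact hr)
    rw [hej, hj] at hget
    -- Substitution keeps polarity and axis, so a ray `+v(…)` can only come from a north side.
    rcases sideRay_eq_some (hasRay_iff.1 hr) with ⟨-, rfl⟩ | ⟨-, rfl⟩ | ⟨-, rfl⟩ | ⟨hi, rfl⟩
    · rw [subst_hRay, subst_hRay] at hget
      cases hget
    · rw [subst_vRay, subst_vRay] at hget
      cases hget
    · rw [subst_hRay, subst_hRay] at hget
      injection hget with _ h _
      exact absurd h.symm hColour_ne_vColour
    · rw [vRay_subst hp hψ hu v] at hget
      simp only at hi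
      subst hi
      -- A north side with a `cell` colour fits an eastern guard and would be linked; being free,
      -- this one has a `result` colour.
      obtain ⟨n', c', hn', hc', hs', hnorth⟩ : ∃ n' c', (p v).2 = n' + 1 ∧ M.run w n' = some c' ∧
          M.step c' = none ∧ (tileAt δ v).north = .result (c'.cell (p v).1) := by
        rcases shows hp hO v with ⟨d, b, -, hnorth, -⟩ | h
        · obtain ⟨u', hu', he'⟩ := exists_link (k := N) (l := S) (v := v)
            (i := Sum.inl (idx.symm (.inr (.inr (tileAt δ v).north)))) (p v) (p v + (0, 1))
            (hp.1 v) rfl (.inr (.inr (.inl ⟨rfl, rfl, rfl⟩)))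
            (.inr (.inr (.inl ⟨rfl, rfl, by
              rw [tile_star, simulation_tile]
              refine congrArg col ?_
              simp [colourTile, program, eastGuard, hnorth, Colour.notHigh]⟩)))
            (fun r hr ⟨i, s, hs, hd⟩ hf => hC _ hf r hr i s hs hd)
          exact absurd he' (hfree.2 _)
        · exact h
      obtain ⟨rfl, rfl⟩ := halting_unique hc' hc hs' hs
      refine ⟨(p v).1, h4 v hn', _, ?_, hget.trans (by rw [hn'])⟩
      rw [decode_north, hnorth]; rfl

theorem halts_iff_exec_nonempty (col : Colour (Γ × Option Q) ≃ C)
    (idx : Fin k ≃ TileName (Γ × Option Q)) (w : List Γ) :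
    M.Halts w ↔ (exec Set.univ (M.simulation col idx w).constellation).Nonempty := by
  constructor
  · rintro ⟨n, c, hc, hs⟩
    obtain ⟨δ, p, hp, hC⟩ := exists_closed_diagram col idx hc hs
    obtain ⟨u, q, hu⟩ := exists_pinned hp (openToNorthOnly_of_closed hC)
    obtain ⟨σ, hσ⟩ := exists_isActualisation hp hu
    exact ⟨σ, δ, correct_iff.2 ⟨p, hp⟩, hC.saturated, hσ⟩
  · rintro ⟨σ, δ, hcor, hsat, -⟩
    obtain ⟨p, hp⟩ := correct_iff.1 hcor
    obtain ⟨v, n, c, -, hc, hs⟩ := exists_result_row hp hsat.closed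
    exact ⟨n, c, hc, hs⟩

end RightTM.Machine

theorem mainTheorem7 :
    -- Wang tiles: diagrams correspond to finite tilings.
    (∀ (C : Type) [Countable C] (T : Wang.TileSet C),
      (∀ δ : T.Diag, δ.Correct ↔ ∃ p, Wang.IsPlacement δ p) ∧
      (∀ (δ : T.Diag) (p q : Fin δ.size → ℕ × ℕ), Wang.IsPlacement δ p → Wang.IsPlacement δ q →
        ∀ u v, p u + q v = q u + p v) ∧
      (∀ (D : Finset (ℕ × ℕ)) (τ : ℕ × ℕ → T.index),
        Wang.ConnectedRegion D → Wang.IsTiling T D τ →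
        ∃ (δ : T.Diag) (p : Fin δ.size → ℕ × ℕ), δ.Correct ∧ Wang.IsFlat δ p ∧
          Set.range p = D ∧ (∀ v, δ.star v = τ (p v)) ∧
          ∀ (η : T.Diag) (q : Fin η.size → ℕ × ℕ), Wang.IsFlat η q → Set.range q = D →
            (∀ v, η.star v = τ (q v)) → η.Sub δ ∧ δ.Sub η) ∧
      (∀ (δ : T.Diag) (p : Fin δ.size → ℕ × ℕ), Wang.IsFlat δ p →
        ∃ (D : Finset (ℕ × ℕ)) (τ : ℕ × ℕ → T.index),
          Wang.ConnectedRegion D ∧ Wang.IsTiling T D τ ∧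
          Set.range p = D ∧ ∀ v, δ.star v = τ (p v))) ∧
    -- Simulation of Turing machines.
    (∀ (Q Γ : Type) [Finite Q] [Finite Γ] (M : RightTM.Machine Q Γ),
      ∃ (m k : ℕ) (program : Fin k → Wang.Tile (Fin m))
        (input lastInput : Γ × Option Q → Wang.Tile (Fin m))
        (decode : Fin m → Γ × Option Q),
      ∀ w : List Γ,
        -- halting
        (M.Halts w ↔
          (Stellar.exec Set.univ (M.tileSet program input lastInput w).constellation).Nonempty) ∧
        -- the final configuration is read off from the result of the execution
        (∀ (n : ℕ) (c : RightTM.Config Q Γ), M.run w n = some c → M.step c = none →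
          ∀ σ ∈ Stellar.exec Set.univ (M.tileSet program input lastInput w).constellation,
          ∃ N : ℕ, c.head ≤ N ∧ (∀ i, N < i → c.tape i = M.blank) ∧
            (∀ i ≤ N, ∃ a, decode a = c.cell i ∧
              Wang.vRay .pos a (Wang.num i) (Wang.num (n + 2)) ∈ σ.1) ∧
            (∀ ts, Stellar.Ray.polarised .pos Wang.vColour ts ∈ σ.1 →
              ∃ i ≤ N, ∃ a, decode a = c.cell i ∧
                Stellar.Ray.polarised .pos Wang.vColour ts =
                  Wang.vRay .pos a (Wang.num i) (Wang.num (n + 2)))) ∧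
        -- every finite part of the run has a space-time diagram
        (∀ n, (M.run w n).isSome → ∀ N > w.length + n,
          ∃ (δ : (M.tileSet program input lastInput w).Diag) (p : Fin δ.size → ℕ × ℕ),
            δ.Correct ∧ Wang.IsFlat δ p ∧ Wang.OpenToNorthOnly δ ∧
            Set.range p = {d | d.1 ≤ N ∧ d.2 ≤ n} ∧
            ∀ v, ∃ c, M.run w (p v).2 = some c ∧
              decode ((M.tileSet program input lastInput w).tile (δ.star v)).north =
                c.cell (p v).1) ∧
        -- conversely, diagrams show nothing but the run
        (∀ (δ : (M.tileSet program input lastInput w).Diag) (p : Fin δ.size → ℕ × ℕ),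
          δ.Correct → Wang.IsPlacement δ p → Wang.OpenToNorthOnly δ →
          ∀ v, ∃ n c, M.run w n = some c ∧
            ((p v).2 = n ∨ ((p v).2 = n + 1 ∧ M.step c = none)) ∧
            decode ((M.tileSet program input lastInput w).tile (δ.star v)).north =
              c.cell (p v).1)) := by
  refine ⟨fun C _ T => ⟨fun δ => Wang.correct_iff, fun δ p q hp hq => Wang.placement_unique hp hq,
    fun D τ hD hτ => Wang.exists_flat_diagram hD hτ, fun δ p hp => hp.exists_tiling⟩,
    fun Q Γ _ _ M => ?_⟩
  obtain ⟨m, ⟨col⟩⟩ := Finite.exists_equiv_fin (RightTM.Colour (Γ × Option Q))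
  obtain ⟨k, ⟨idx⟩⟩ := Finite.exists_equiv_fin (RightTM.Machine.TileName (Γ × Option Q))
  -- The three tile families are found by unfolding `simulation`; they involve `col` and `idx`,
  -- chosen before `w`, and so depend on `M` only.
  refine ⟨m, k, _, _, _, M.decode col, fun w =>
    ⟨RightTM.Machine.halts_iff_exec_nonempty col idx.symm w,
      fun n c hc hs σ hσ => RightTM.Machine.exec_spec hc hs hσ, fun n hn N hN => ?_,
      fun δ p _ hp hO v => ?_⟩⟩
  · obtain ⟨δ, p, hc, hf, hO, hr, h⟩ :=
      RightTM.Machine.exists_run_diagram (last := N) col idx.symm hn hN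
    refine ⟨δ, p, hc, hf, hO, hr, fun v => ?_⟩
    obtain ⟨c, l, r, hc, -, hnorth⟩ := h v
    refine ⟨c, hc, (RightTM.Machine.decode_north v).trans ?_⟩
    rw [hnorth]; rfl
  · rcases RightTM.Machine.shows hp hO v with ⟨c, r, hc, hnorth, -⟩ | ⟨n, c, hn, hc, hs, hnorth⟩
    · refine ⟨_, c, hc, .inl rfl, (RightTM.Machine.decode_north v).trans ?_⟩
      rw [hnorth]; rfl
    · refine ⟨n, c, hc, .inr ⟨hn, hs⟩, (RightTM.Machine.decode_north v).trans ?_⟩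
      rw [hnorth]; rfl
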